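/- Let $k\ge 1$, $d_1,\dots,d_k\ge 1$, $d=\sum_i d_i$, $\sigma>0$, and split the coordinates of $\mathbb{R}^d$ into disjoint blocks $S_1,\dots,S_k$ with $|S_i|=d_i$; write $x_{S_i}$ for the block $S_i$ of $x$. Let $\Sigma_i\in\mathbb{R}^{d_i\times d_i}$ be positive semidefinite. A noisy feature vector of class $i$ is $x=\bar s+e$, where the clean vector $\bar s$ equals a Gaussian signal $s\sim\mathcal N(0,\Sigma_i)$ on $S_i$ and $0$ on all other blocks, and $e\sim\mathcal N(0,\sigma^2I_d)$ is independent of $s$. Put $C_i=\Sigma_i+\sigma^2I_{d_i}$ (the covariance of $x_{S_i}$ in class $i$) and $M=\max_i\|C_i\|_2$. The training data are labels $Y\in\{1,\dots,k\}^n$ and independent rows $\bar X_1,\dots,\bar X_n$, row $j$ being a noisy feature vector of class $Y_j$. Let $n_i=|\{j:Y_j=i\}|$, and assume balanced loading: $n_i\le\rho\,n_j$ for all $i,j$, with some $\rho\ge1$. Let $$\hat C_i=\frac1{n_i}\,\bar X_{i,S_i}^{\top}\bar X_{i,S_i},$$ where $\bar X_{i,S_i}\in\mathbb{R}^{n_i\times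 d_i}$ consists of the rows with $Y_j=i$ and the columns $S_i$. The QDA router, which knows $\sigma^2$, sends $x\in\mathbb{R}^d$ to a class $\hat y(x)\in\arg\max_i\hat\delta_i(x)$ (with any jointly measurable rule for ties), where $$\hat\delta_i(x)=-\tfrac12\log|\hat C_i|-\tfrac12x_{S_i}^\top\hat C_i^{-1}x_{S_i}-\tfrac12\sum_{j\ne i}\Big(d_j\log\sigma^2+\frac{\|x_{S_j}\|^2}{\sigma^2}\Big)$$ is, up to a common additive constant, the Gaussian log-density with covariance $\hat C_i$ on block $S_i$ and $\sigma^2I$ on the other blocks. For a measurable $h:\mathbb{R}^d\to\{1,\dots,k\}$ let $R(h)$ be its misclassification probability at a fresh noisy feature vector whose class is uniform on $\{1,\dots,k\}$. Let $R=R(\hat y)$, conditionally on the training data, and let $R^*=\inf_hR(h)$ be the Bayes risk. Then there is an absolute constant $c>0$ such that for all $k$, $(d_i)$, $\sigma$, $\rho$ there is a constant $C$ with $0<C\le c\,\rho\,k\,\max_id_i/\sigma^4$ for which the following holds for all $\Sigma_1,\dots,\Sigma_k$, all $\epsilon>0$, all $\delta\in(0,1)$, all $n$ and all balanced labels $Y$: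 if $$n\ \ge\ C\,\frac{M^2}{\epsilon^2}\sum_{i=1}^k\max\Big\{d_i,\log\frac k\delta\Big\},$$ then $R-R^*\le\epsilon$ with probability at least $1-\delta$ over the training data. -/

import Mathlib

open MeasureTheory ProbabilityTheory

noncomputable section

namespace BlockQDA

/-- The feature space `ℝ^d`, `d = d 0 + ⋯ + d (k-1)`, with its coordinates grouped into the `k`
disjoint feature blocks: `x i` is the vector of the `d i` coordinates in the feature set of
block `i`. -/
abbrev Features (k : ℕ) (d : Fin k → ℕ) : Type :=
  (i : Fin k) → EuclideanSpace ℝ (Fin (d i))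

variable {k : ℕ} {d : Fin k → ℕ}

/-- The feature noise: all coordinates are independent `N(0, σ²)`. -/
def noiseLaw (d : Fin k → ℕ) (σ : ℝ) : Measure (Features k d) :=
  Measure.pi fun i => multivariateGaussian 0 (σ ^ 2 • (1 : Matrix (Fin (d i)) (Fin (d i)) ℝ))

/-- The law of a noisy feature vector of class `i`: a clean signal `N(0, Σ_i)` placed in block `i`
(all other blocks of the clean vector vanish), plus independent noise on all coordinates. -/
def classLaw (S : (i : Fin k) → Matrix (Fin (d i)) (Fin (d i)) ℝ) (σ : ℝ) (i : Fin k) :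
    Measure (Features k d) :=
  ((multivariateGaussian 0 (S i)).prod (noiseLaw d σ)).map fun p => Pi.single i p.1 + p.2

/-- The law of the noisy design matrix: `n` independent rows, row `j` of class `Y j`. -/
def trainingLaw (S : (i : Fin k) → Matrix (Fin (d i)) (Fin (d i)) ℝ) (σ : ℝ) {n : ℕ}
    (Y : Fin n → Fin k) : Measure (Fin n → Features k d) :=
  Measure.pi fun j => classLaw S σ (Y j)

/-- The covariance `C_i = Σ_i + σ² I` of the noisy features of block `i` in class `i`. -/
def blockCov (S : (i : Fin k) → Matrix (Fin (d i)) (Fin (d i)) ℝ) (σ : ℝ) (i : Fin k) :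
    Matrix (Fin (d i)) (Fin (d i)) ℝ :=
  S i + σ ^ 2 • 1

/-- `M`, the largest spectral norm of a block covariance. -/
def maxCovNorm (S : (i : Fin k) → Matrix (Fin (d i)) (Fin (d i)) ℝ) (σ : ℝ) : ℝ :=
  ⨆ i, ‖Matrix.toEuclideanCLM (𝕜 := ℝ) (blockCov S σ i)‖

/-- The number `n_i` of training rows of class `i`. -/
def classCount {n : ℕ} (Y : Fin n → Fin k) (i : Fin k) : ℕ :=
  (Finset.univ.filter fun j => Y j = i).card

/-- The sample covariance of block `i`: the rows with label `i`, the columns of block `i`, and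
`(1 / n_i) Xᵀ X` of that submatrix. -/
def sampleCov {n : ℕ} (Y : Fin n → Fin k) (X : Fin n → Features k d) (i : Fin k) :
    Matrix (Fin (d i)) (Fin (d i)) ℝ :=
  Matrix.of fun a b =>
    (classCount Y i : ℝ)⁻¹ * ∑ j ∈ Finset.univ.filter (fun j => Y j = i), X j i a * X j i b

/-- The Gaussian score `-½ log |A| - ½ xᵀ A⁻¹ x`. -/
def gaussScore {m : ℕ} (A : Matrix (Fin m) (Fin m) ℝ) (x : EuclideanSpace ℝ (Fin m)) : ℝ :=
  -(1 / 2) * Real.log A.det - (1 / 2) * (x.ofLp ⬝ᵥ A⁻¹.mulVec x.ofLp)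

/-- The QDA discriminant of class `i`: up to an additive constant independent of `i`, the Gaussian
log-density at `x` whose covariance is block-diagonal with the sample covariance in block `i` and
the known noise covariance `σ² I` in every other block. -/
def qdaScore (σ : ℝ) {n : ℕ} (Y : Fin n → Fin k) (X : Fin n → Features k d) (i : Fin k)
    (x : Features k d) : ℝ :=
  gaussScore (sampleCov Y X i) (x i) +
    ∑ j ∈ Finset.univ.erase i, gaussScore (σ ^ 2 • (1 : Matrix (Fin (d j)) (Fin (d j)) ℝ)) (x j)

/-- `h` is a QDA router trained on `(X, Y)`: `h x` maximizes the discriminant at `x`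
(with any rule for ties). -/
def IsQDARouter (σ : ℝ) {n : ℕ} (Y : Fin n → Fin k) (X : Fin n → Features k d)
    (h : Features k d → Fin k) : Prop :=
  ∀ x i, qdaScore σ Y X i x ≤ qdaScore σ Y X (h x) x

/-- Misclassification risk of `h` at a fresh test point whose class is uniform on `{1, …, k}`. -/
def misclassRisk (S : (i : Fin k) → Matrix (Fin (d i)) (Fin (d i)) ℝ) (σ : ℝ)
    (h : Features k d → Fin k) : ℝ :=
  (k : ℝ)⁻¹ * ∑ i, (classLaw S σ i).real {x | h x ≠ i}

/-- The Bayes risk: the least misclassification risk over all measurable classifiers. -/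
def optimalRisk (S : (i : Fin k) → Matrix (Fin (d i)) (Fin (d i)) ℝ) (σ : ℝ) : ℝ :=
  ⨅ h : {h : Features k d → Fin k // Measurable h}, misclassRisk S σ h.1

end BlockQDA

end

noncomputable section

namespace BlockQDA

open Matrix WithLp
open scoped ENNReal MatrixOrder RealInnerProductSpace

variable {k : ℕ} {d : Fin k → ℕ}

/-! Relative to the pure noise law, the density of class `i` depends on block `i` only: it is the
ratio of the Gaussian densities with covariances `C_i` and `σ² I`. Up to a summand common to all
classes, the QDA score is the logarithm of the same ratio with `C_i` replaced by the sample
covariance, so the router is a plug-in rule. Its excess risk is therefore at most the average over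
`i` of the `L¹` distances between the true and estimated block Gaussians (`plugin_integral_le`,
`misclassRisk_sub_optimalRisk_le`).

Each `L¹` distance is controlled by a chi-square computation. If `A` is the whitened error
`C_i^{-1/2} Ĉ_i C_i^{-1/2} - 1`, the second moment of the density ratio is `det (1 - A²)^{-1/2}`,
which is at most `1 + d_i ‖A‖²` for small `A`. Hence the distance is at most about `√d_i ‖A‖`, and
it suffices that `‖A‖` be of order `ε / √d_i` (`integral_abs_one_sub_gaussRatio_le`).

In each direction the sample variance is an average of scaled chi-squares, so a Chernoff bound
applies; a net of exponential size in `d_i` upgrades it to the operator norm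
(`trainingLaw_whitenedError_tail`). A union bound over classes asks for `n_i ≳ d_i max(d_i, log
(k/δ)) / ε²`. Balanced loading gives `n ≤ k ρ n_i`. Whitening makes all this scale-free, so `M`
enters only through `M ≥ σ²`, which cancels the `σ⁴` in the denominator of `C`. -/

/-! ### Densities of Gaussian laws -/

/-- A product of densities is a density of the product measure. -/
theorem pi_withDensity {ι : Type*} [Fintype ι] {E : ι → Type*} [∀ i, MeasurableSpace (E i)]
    (μ : (i : ι) → Measure (E i)) [∀ i, SigmaFinite (μ i)] (f : (i : ι) → E i → ℝ)
    (h0 : ∀ i x, 0 ≤ f i x) (hi : ∀ i, Integrable (f i) (μ i)) :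
    Measure.pi (fun i => (μ i).withDensity fun x => ENNReal.ofReal (f i x)) =
      (Measure.pi μ).withDensity fun x => ENNReal.ofReal (∏ i, f i (x i)) := by
  refine Measure.pi_eq fun s hs => ?_
  have hbox : MeasurableSet (Set.univ.pi s) := MeasurableSet.univ_pi hs
  rw [withDensity_apply _ hbox, Measure.restrict_pi_pi,
    ← ofReal_integral_eq_lintegral_ofReal
      (Integrable.fintype_prod_dep fun i => (hi i).restrict)
      (ae_of_all _ fun x => Finset.prod_nonneg fun i _ => h0 i _),
    integral_fintype_prod_eq_prod (f := f),
    ENNReal.ofReal_prod_of_nonneg fun i _ => integral_nonneg (h0 i)]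
  refine Finset.prod_congr rfl fun i _ => ?_
  rw [withDensity_apply _ (hs i), ofReal_integral_eq_lintegral_ofReal (hi i).restrict
    (ae_of_all _ (h0 i))]

/-- The normalizing constant of the Gaussian density on `ℝ^m`. -/
def gaussConst (m : ℕ) : ℝ := (√(2 * Real.pi))⁻¹ ^ m

theorem gaussConst_pos (m : ℕ) : 0 < gaussConst m := by
  unfold gaussConst; positivity

theorem stdGaussian_eq_withDensity (m : ℕ) :
    stdGaussian (EuclideanSpace ℝ (Fin m)) = volume.withDensity fun x =>
      ENNReal.ofReal (gaussConst m * Real.exp (-(1 / 2) * (x.ofLp ⬝ᵥ x.ofLp))) := by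
  rw [← map_pi_eq_stdGaussian]
  have h1 : gaussianReal 0 1 = volume.withDensity
      fun x => ENNReal.ofReal (gaussianPDFReal 0 1 x) := by
    rw [gaussianReal_of_var_ne_zero _ one_ne_zero]; rfl
  have h2 := pi_withDensity (ι := Fin m) (fun _ => (volume : Measure ℝ))
    (fun _ => gaussianPDFReal 0 1)
    (fun _ => gaussianPDFReal_nonneg 0 1) (fun _ => integrable_gaussianPDFReal 0 1)
  rw [← h1] at h2
  rw [h2, ← volume_pi]
  have h3 := (PiLp.volume_preserving_toLp (Fin m))
  ext s hs
  rw [Measure.map_apply h3.measurable hs, withDensity_apply _ (h3.measurable hs),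
    withDensity_apply _ hs, ← h3.setLIntegral_comp_preimage hs (by fun_prop)]
  refine lintegral_congr fun x => ?_
  congr 1
  simp only [gaussianPDFReal, gaussConst, sub_zero, NNReal.coe_one, mul_one]
  rw [Finset.prod_mul_distrib, Finset.prod_const, Finset.card_univ, Fintype.card_fin,
    ← Real.exp_sum]
  congr 2
  rw [dotProduct, Finset.mul_sum]
  exact Finset.sum_congr rfl fun i _ => by ring

theorem measurable_gaussScore {m : ℕ} (A : Matrix (Fin m) (Fin m) ℝ) :
    Measurable (gaussScore A) := by
  unfold gaussScore dotProduct mulVec dotProduct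
  fun_prop

theorem posDef_sqrt {m : ℕ} {A : Matrix (Fin m) (Fin m) ℝ} (hA : A.PosDef) :
    (CFC.sqrt A).PosDef ∧ CFC.sqrt A * CFC.sqrt A = A := by
  have h := CFC.sqrt_mul_sqrt_self A hA.posSemidef.nonneg
  refine ⟨?_, h⟩
  have hs : (CFC.sqrt A).PosSemidef := (CFC.sqrt_nonneg A).posSemidef
  rw [hs.posDef_iff_isUnit, isUnit_iff_isUnit_det]
  have : IsUnit (CFC.sqrt A * CFC.sqrt A).det := by
    rw [h]; exact hA.det_pos.ne'.isUnit
  rw [det_mul] at this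
  exact isUnit_of_mul_isUnit_left this

theorem mulVec_dotProduct {m : ℕ} {B : Matrix (Fin m) (Fin m) ℝ} (hB : B.IsHermitian)
    (v w : Fin m → ℝ) : (B *ᵥ v) ⬝ᵥ w = v ⬝ᵥ (B *ᵥ w) := by
  have h : Bᵀ = B := by rw [← conjTranspose_eq_transpose_of_trivial]; exact hB
  rw [dotProduct_comm, dotProduct_mulVec, ← mulVec_transpose, h, dotProduct_comm]

/-- The law is the image of the standard Gaussian under the square root of `A`; the linear change of
variables contributes the Jacobian `det √A`, whose logarithm is half of `log det A`. -/
theorem multivariateGaussian_eq_withDensity {m : ℕ} {A : Matrix (Fin m) (Fin m) ℝ}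
    (hA : A.PosDef) :
    multivariateGaussian 0 A = volume.withDensity fun x =>
      ENNReal.ofReal (gaussConst m * Real.exp (gaussScore A x)) := by
  obtain ⟨hB, hBA⟩ := posDef_sqrt hA
  set B := CFC.sqrt A with hBdef
  have hBdet := hB.det_pos
  have hlin : LinearMap.det (toEuclideanCLM (𝕜 := ℝ) B : EuclideanSpace ℝ (Fin m) →ₗ[ℝ] _) =
      B.det := by
    rw [coe_toEuclideanCLM_eq_toEuclideanLin, toEuclideanLin_eq_toLin_orthonormal,
      LinearMap.det_toLin]
  have hmap := Measure.map_linearMap_addHaar_eq_smul_addHaar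
    (volume : Measure (EuclideanSpace ℝ (Fin m))) (hlin ▸ hBdet.ne')
  rw [hlin] at hmap
  have hmeas := measurable_gaussScore A
  have hdens : ∀ x : EuclideanSpace ℝ (Fin m),
      ENNReal.ofReal (gaussConst m * Real.exp (-(1 / 2) * (x.ofLp ⬝ᵥ x.ofLp))) =
      ENNReal.ofReal B.det *
        ENNReal.ofReal (gaussConst m * Real.exp (gaussScore A (toEuclideanCLM (𝕜 := ℝ) B x))) := by
    intro x
    rw [← ENNReal.ofReal_mul hBdet.le]
    congr 1
    rw [gaussScore, ofLp_toEuclideanCLM]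
    have e1 : (B *ᵥ x.ofLp) ⬝ᵥ A⁻¹ *ᵥ (B *ᵥ x.ofLp) = x.ofLp ⬝ᵥ x.ofLp := by
      have hu : IsUnit B.det := hBdet.ne'.isUnit
      rw [mulVec_mulVec, ← hBA, Matrix.mul_inv_rev, Matrix.mul_assoc, nonsing_inv_mul _ hu,
        Matrix.mul_one, mulVec_dotProduct hB.isHermitian, mulVec_mulVec, mul_nonsing_inv _ hu,
        one_mulVec]
    rw [e1, ← hBA, det_mul, Real.log_mul hBdet.ne' hBdet.ne',
      show -(1 / 2) * (Real.log B.det + Real.log B.det) - 1 / 2 * (x.ofLp ⬝ᵥ x.ofLp) =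
        -Real.log B.det + -(1 / 2) * (x.ofLp ⬝ᵥ x.ofLp) by ring, Real.exp_add, Real.exp_neg,
      Real.exp_log hBdet]
    field_simp
  rw [multivariateGaussian, stdGaussian_eq_withDensity]
  simp only [zero_add, ← hBdef]
  ext s hs
  have hTm : Measurable (toEuclideanCLM (𝕜 := ℝ) B) := by fun_prop
  rw [Measure.map_apply hTm hs, withDensity_apply _ (hTm hs), withDensity_apply _ hs]
  simp only [hdens]
  rw [lintegral_const_mul _ (by fun_prop)]
  rw [← setLIntegral_map hs (f := fun x => ENNReal.ofReal (gaussConst m * Real.exp (gaussScore A x)))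
    (by fun_prop) hTm]
  have : Measure.map (toEuclideanCLM (𝕜 := ℝ) B) (volume : Measure (EuclideanSpace ℝ (Fin m))) =
    ENNReal.ofReal |(B.det)⁻¹| • volume := hmap
  rw [this, Measure.restrict_smul, lintegral_smul_measure, smul_eq_mul, ← mul_assoc,
    ← ENNReal.ofReal_mul hBdet.le, abs_of_pos (inv_pos.2 hBdet), mul_inv_cancel₀ hBdet.ne',
    ENNReal.ofReal_one, one_mul]

/-- The ratio of the Gaussian densities with covariances `A` and `B`. -/
def gaussRatio {m : ℕ} (A B : Matrix (Fin m) (Fin m) ℝ) (x : EuclideanSpace ℝ (Fin m)) : ℝ :=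
  Real.exp (gaussScore A x - gaussScore B x)

theorem measurable_gaussRatio {m : ℕ} (A B : Matrix (Fin m) (Fin m) ℝ) :
    Measurable (gaussRatio A B) :=
  ((measurable_gaussScore A).sub (measurable_gaussScore B)).exp

theorem gaussRatio_pos {m : ℕ} (A B : Matrix (Fin m) (Fin m) ℝ) (x : EuclideanSpace ℝ (Fin m)) :
    0 < gaussRatio A B x := Real.exp_pos _

theorem gaussRatio_mul {m : ℕ} (A B C : Matrix (Fin m) (Fin m) ℝ)
    (x : EuclideanSpace ℝ (Fin m)) :
    gaussRatio A B x * gaussRatio B C x = gaussRatio A C x := by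
  rw [gaussRatio, gaussRatio, gaussRatio, ← Real.exp_add]; ring_nf

theorem multivariateGaussian_eq_withDensity_gaussRatio {m : ℕ} {A B : Matrix (Fin m) (Fin m) ℝ}
    (hA : A.PosDef) (hB : B.PosDef) :
    multivariateGaussian 0 A = (multivariateGaussian 0 B).withDensity fun x =>
      ENNReal.ofReal (gaussRatio A B x) := by
  have hmA := measurable_gaussScore A
  have hmB := measurable_gaussScore B
  have hmR := measurable_gaussRatio A B
  rw [multivariateGaussian_eq_withDensity hA, multivariateGaussian_eq_withDensity hB,
    ← withDensity_mul _ (by fun_prop) (by fun_prop)]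
  congr 1
  ext x
  rw [Pi.mul_apply, ← ENNReal.ofReal_mul (by have := gaussConst_pos m; positivity), mul_assoc,
    gaussRatio, ← Real.exp_add]
  ring_nf

theorem integrable_gaussRatio {m : ℕ} {A B : Matrix (Fin m) (Fin m) ℝ}
    (hA : A.PosDef) (hB : B.PosDef) :
    Integrable (gaussRatio A B) (multivariateGaussian 0 B) ∧
      ∫ x, gaussRatio A B x ∂multivariateGaussian 0 B = 1 := by
  have h : ∫⁻ x, ENNReal.ofReal (gaussRatio A B x) ∂multivariateGaussian 0 B = 1 := by
    rw [← setLIntegral_univ, ← withDensity_apply _ MeasurableSet.univ,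
      ← multivariateGaussian_eq_withDensity_gaussRatio hA hB, measure_univ]
  have hm := measurable_gaussRatio A B
  have h0 : 0 ≤ᵐ[multivariateGaussian 0 B] gaussRatio A B :=
    ae_of_all _ fun x => (gaussRatio_pos A B x).le
  refine ⟨⟨hm.aestronglyMeasurable, ?_⟩, ?_⟩
  · rw [hasFiniteIntegral_iff_ofReal h0, h]; simp
  · rw [integral_eq_lintegral_of_nonneg_ae h0 hm.aestronglyMeasurable, h]; simp

/-! ### `L¹` distance of Gaussians through the chi-square divergence -/

theorem norm_sq_eq_dotProduct {m : ℕ} (x : EuclideanSpace ℝ (Fin m)) :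
    ‖x‖ ^ 2 = x.ofLp ⬝ᵥ x.ofLp := by
  rw [EuclideanSpace.real_norm_sq_eq, dotProduct]
  exact Finset.sum_congr rfl fun i _ => by ring

theorem abs_eigenvalue_le {m : ℕ} {A : Matrix (Fin m) (Fin m) ℝ} (hA : A.IsHermitian) {η : ℝ}
    (h : ‖toEuclideanCLM (𝕜 := ℝ) A‖ ≤ η) (i : Fin m) : |hA.eigenvalues i| ≤ η := by
  have h1 := (toEuclideanCLM (𝕜 := ℝ) A).le_of_opNorm_le h (hA.eigenvectorBasis i)
  have h2 : toEuclideanCLM (𝕜 := ℝ) A (hA.eigenvectorBasis i) =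
      hA.eigenvalues i • hA.eigenvectorBasis i :=
    (WithLp.ofLp_injective 2) (hA.mulVec_eigenvectorBasis i)
  rwa [h2, norm_smul, (hA.eigenvectorBasis.orthonormal.1 i), mul_one, mul_one,
    Real.norm_eq_abs] at h1

/-- `1 - A²` factors as `(1 - A)(1 + A)`, and up to sign these determinants are the values at `1`
and `-1` of the characteristic polynomial, which splits over the eigenvalues. -/
theorem det_one_sub_sq {m : ℕ} {A : Matrix (Fin m) (Fin m) ℝ} (hA : A.IsHermitian) :
    (1 - A * A).det = ∏ i, (1 - hA.eigenvalues i ^ 2) := by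
  have h1 := eval_charpoly A 1
  have h2 := eval_charpoly A (-1)
  rw [hA.charpoly_eq, Polynomial.eval_prod] at h1 h2
  simp only [RCLike.ofReal_real_eq_id, id_eq, Polynomial.eval_sub, Polynomial.eval_X,
    Polynomial.eval_C, map_one, map_neg] at h1 h2
  have h3 : 1 - A * A = -((1 - A) * (-1 - A)) := by noncomm_ring
  rw [h3, det_neg, det_mul, ← h1, ← h2, ← Finset.prod_mul_distrib, ← Finset.card_univ,
    ← Finset.prod_const, ← Finset.prod_mul_distrib]
  exact Finset.prod_congr rfl fun i _ => by ring

/-- Every eigenvalue lies in `[-η, η]`, so the product of the `1 - λ²` is at least `(1 - η²)^m`;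
Bernoulli's inequality finishes. -/
theorem one_sub_le_det_one_sub_sq {m : ℕ} {A : Matrix (Fin m) (Fin m) ℝ} (hA : A.IsHermitian)
    {η : ℝ} (h : ‖toEuclideanCLM (𝕜 := ℝ) A‖ ≤ η) (hη : η ≤ 1) :
    1 - m * η ^ 2 ≤ (1 - A * A).det := by
  have hη0 : 0 ≤ η := (norm_nonneg _).trans h
  rw [det_one_sub_sq hA]
  calc 1 - m * η ^ 2 = 1 + (m : ℝ) * (-η ^ 2) := by ring
    _ ≤ (1 + -η ^ 2) ^ m := one_add_mul_le_pow (by nlinarith) m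
    _ = ∏ _i : Fin m, (1 + -η ^ 2) := by simp
    _ ≤ _ := Finset.prod_le_prod (fun i _ => by nlinarith) fun i _ => by
      have := sq_le_sq' (abs_le.1 (abs_eigenvalue_le hA h i)).1
        (abs_le.1 (abs_eigenvalue_le hA h i)).2
      linarith

theorem dotProduct_mulVec_le {m : ℕ} {A : Matrix (Fin m) (Fin m) ℝ} {η : ℝ}
    (h : ‖toEuclideanCLM (𝕜 := ℝ) A‖ ≤ η) (x : EuclideanSpace ℝ (Fin m)) :
    |x.ofLp ⬝ᵥ A *ᵥ x.ofLp| ≤ η * ‖x‖ ^ 2 := by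
  rw [← inner_toEuclideanCLM]
  calc _ ≤ ‖x‖ * ‖toEuclideanCLM (𝕜 := ℝ) A x‖ := abs_real_inner_le_norm _ _
    _ ≤ ‖x‖ * (η * ‖x‖) := by gcongr; exact (toEuclideanCLM (𝕜 := ℝ) A).le_of_opNorm_le h x
    _ = _ := by ring

theorem posDef_one_add {m : ℕ} {A : Matrix (Fin m) (Fin m) ℝ} (hA : A.IsHermitian) {η : ℝ}
    (h : ‖toEuclideanCLM (𝕜 := ℝ) A‖ ≤ η) (hη : η < 1) : (1 + A).PosDef := by
  refine PosDef.of_dotProduct_mulVec_pos (isHermitian_one.add hA) fun x hx => ?_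
  have h1 := abs_le.1 (dotProduct_mulVec_le h (toLp 2 x))
  have h2 : 0 < ‖toLp 2 x‖ ^ 2 := by
    have : toLp 2 x ≠ 0 := fun h0 => hx (by simpa using congrArg ofLp h0)
    positivity
  rw [norm_sq_eq_dotProduct] at h1 h2
  simp only [star_trivial, add_mulVec, one_mulVec, dotProduct_add]
  simp only at h1 h2
  nlinarith [h1.1]

theorem norm_neg_mul_self_le {m : ℕ} {A : Matrix (Fin m) (Fin m) ℝ} {η : ℝ}
    (h : ‖toEuclideanCLM (𝕜 := ℝ) A‖ ≤ η) :
    ‖toEuclideanCLM (𝕜 := ℝ) (-(A * A))‖ ≤ η ^ 2 := by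
  rw [map_neg, norm_neg, map_mul, sq]
  exact (norm_mul_le _ _).trans (mul_le_mul h h (norm_nonneg _) ((norm_nonneg _).trans h))

/-- The second moment of the ratio of two Gaussian densities. -/
theorem integral_gaussRatio_sq {m : ℕ} {C P D : Matrix (Fin m) (Fin m) ℝ}
    (hC : C.PosDef) (hD : D.PosDef) (hinv : D⁻¹ = 2 • P⁻¹ - C⁻¹) :
    Integrable (fun x => gaussRatio P C x ^ 2) (multivariateGaussian 0 C) ∧
      ∫ x, gaussRatio P C x ^ 2 ∂multivariateGaussian 0 C =
        Real.exp (-(Real.log P.det) + (1 / 2) * Real.log C.det + (1 / 2) * Real.log D.det) := by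
  have hI := integrable_gaussRatio hD hC
  -- The square of the ratio is again a constant times a Gaussian ratio, now with precision `2 P⁻¹ -
  -- C⁻¹`; the ratio integrates to one, so the constant is the second moment.
  have heq : ∀ x, gaussRatio P C x ^ 2 =
      Real.exp (-(Real.log P.det) + (1 / 2) * Real.log C.det + (1 / 2) * Real.log D.det) *
        gaussRatio D C x := by
    intro x
    rw [gaussRatio, gaussRatio, ← Real.exp_nat_mul, ← Real.exp_add]
    congr 1
    simp only [gaussScore, hinv, sub_mulVec, smul_mulVec, dotProduct_sub, dotProduct_smul]
    push_cast
    simp only [nsmul_eq_mul]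
    push_cast
    ring
  simp only [heq]
  refine ⟨hI.1.const_mul _, ?_⟩
  rw [integral_const_mul, hI.2, mul_one]

/-- If the whitened relative error of a covariance matrix is at most `η` in operator norm, then
the corresponding centred Gaussian laws are `L¹`-close. -/
theorem integral_abs_one_sub_gaussRatio_le {m : ℕ} {A B : Matrix (Fin m) (Fin m) ℝ}
    (hB : B.PosDef) (hA : A.IsHermitian) {η s : ℝ}
    (h : ‖toEuclideanCLM (𝕜 := ℝ) A‖ ≤ η) (hη : η < 1) (hs : 0 < s) (hηs : m * η ^ 2 ≤ s ^ 2)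
    (hm : m * η ^ 2 ≤ 1 / 2) :
    (B * (1 + A) * B).PosDef ∧
    ∫ x, |1 - gaussRatio (B * (1 + A) * B) (B * B) x| ∂multivariateGaussian 0 (B * B) ≤ s := by
  have hη0 : 0 ≤ η := (norm_nonneg _).trans h
  have hW := posDef_one_add hA h hη
  have hAA : (A * A).IsHermitian := by
    rw [IsHermitian, conjTranspose_mul, hA.eq]
  have hE : (1 - A * A).PosDef := by
    rw [sub_eq_add_neg]
    exact posDef_one_add hAA.neg (norm_neg_mul_self_le h) (by nlinarith)
  have conj : ∀ {X Y : Matrix (Fin m) (Fin m) ℝ}, X.PosDef → Y.PosDef → (Y * X * Y).PosDef := by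
    intro X Y hX hY
    have := hX.conjTranspose_mul_mul_same (B := Y)
      (mulVec_injective_iff_isUnit.2 hY.isUnit)
    rwa [hY.isHermitian.eq] at this
  have hC : (B * B).PosDef := by simpa using conj PosDef.one hB
  have hP := conj hW hB
  have hD := conj (conj hE.inv hW) hB
  have uB : IsUnit B.det := hB.det_pos.ne'.isUnit
  have uW : IsUnit (1 + A).det := hW.det_pos.ne'.isUnit
  have uE : IsUnit (1 - A * A).det := hE.det_pos.ne'.isUnit
  have hinv : (B * ((1 + A) * (1 - A * A)⁻¹ * (1 + A)) * B)⁻¹ =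
      2 • (B * (1 + A) * B)⁻¹ - (B * B)⁻¹ := by
    have e1 : (1 + A)⁻¹ * (1 - A * A) * (1 + A)⁻¹ = 2 • (1 + A)⁻¹ - 1 := by
      -- Sandwiching this identity between two copies of `(1 + A)⁻¹` shows that the precision is
      -- positive exactly because `A² < 1`.
      have : (1 - A * A) = 2 • (1 + A) - (1 + A) * (1 + A) := by noncomm_ring
      rw [this, Matrix.mul_sub, Matrix.sub_mul, Matrix.mul_smul, Matrix.smul_mul,
        nonsing_inv_mul _ uW, Matrix.one_mul, nonsing_inv_mul_cancel_left _ _ uW, mul_nonsing_inv _ uW]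
    simp only [Matrix.mul_inv_rev, nonsing_inv_nonsing_inv _ uE]
    calc _ = B⁻¹ * ((1 + A)⁻¹ * (1 - A * A) * (1 + A)⁻¹) * B⁻¹ := by simp only [Matrix.mul_assoc]
      _ = _ := by
        rw [e1]; noncomm_ring
  obtain ⟨hI2, hval⟩ := integral_gaussRatio_sq hC hD hinv
  obtain ⟨hI1, hone⟩ := integrable_gaussRatio hP hC
  have hlog : -(Real.log (B * (1 + A) * B).det) + (1 / 2) * Real.log (B * B).det +
      (1 / 2) * Real.log (B * ((1 + A) * (1 - A * A)⁻¹ * (1 + A)) * B).det =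
      -(1 / 2) * Real.log (1 - A * A).det := by
    have b := hB.det_pos.ne'
    have w := hW.det_pos.ne'
    have e := hE.det_pos.ne'
    simp only [det_mul, det_nonsing_inv, Ring.inverse_eq_inv']
    rw [Real.log_mul (by positivity) b, Real.log_mul b w, Real.log_mul b b,
      Real.log_mul (by positivity) b, Real.log_mul b (by positivity),
      Real.log_mul (by positivity) w, Real.log_mul w (by positivity), Real.log_inv]
    ring
  rw [hlog] at hval
  set t := (m : ℝ) * η ^ 2 with ht
  have ht0 : 0 ≤ t := by positivity
  have hdet := one_sub_le_det_one_sub_sq hA h hη.le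
  have hK : Real.exp (-(1 / 2) * Real.log (1 - A * A).det) ≤ 1 + t := by
    rw [← Real.exp_log (show 0 < 1 + t by linarith)]
    refine Real.exp_le_exp.2 ?_
    have h1 : Real.log (1 - t) ≤ Real.log (1 - A * A).det :=
      Real.log_le_log (by linarith) hdet
    -- `(1 + t)² (1 - t) = 1 + t (1 - t - t²)` is at least `1` for `0 ≤ t ≤ 1/2`, that is, `(1 -
    -- t)^{-1/2} ≤ 1 + t`.
    have h3 : 0 ≤ t * (1 - t - t ^ 2) := mul_nonneg ht0 (by nlinarith)
    have h2 : 0 ≤ Real.log ((1 + t) ^ 2 * (1 - t)) := Real.log_nonneg (by linarith)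
    rw [Real.log_mul (by positivity) (by linarith), Real.log_pow] at h2
    push_cast at h2
    linarith
  have hI : Integrable (fun x => 1 - gaussRatio (B * (1 + A) * B) (B * B) x)
      (multivariateGaussian 0 (B * B)) := (integrable_const _).sub hI1
  refine ⟨hP, ?_⟩
  set r := gaussRatio (B * (1 + A) * B) (B * B)
  -- In place of Cauchy–Schwarz, the pointwise bound `|1 - r| ≤ ((1 - r)² + s²) / (2 s)` is
  -- integrated; the mean of `(1 - r)²` is at most `t ≤ s²`.
  calc ∫ x, |1 - r x| ∂multivariateGaussian 0 (B * B)
      ≤ ∫ x, ((1 + s ^ 2) / (2 * s) - r x / s + r x ^ 2 / (2 * s))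
          ∂multivariateGaussian 0 (B * B) := by
        refine integral_mono hI.abs
          (((integrable_const _).sub (hI1.div_const _)).add (hI2.div_const _)) fun x => ?_
        have : (1 + s ^ 2) / (2 * s) - r x / s + r x ^ 2 / (2 * s) =
          (|1 - r x| ^ 2 + s ^ 2) / (2 * s) := by rw [sq_abs]; field_simp; ring
        simp only [this]
        rw [le_div_iff₀ (by positivity)]
        nlinarith [sq_nonneg (|1 - r x| - s)]
    _ = (1 + s ^ 2) / (2 * s) - 1 / s +
          Real.exp (-(1 / 2) * Real.log (1 - A * A).det) / (2 * s) := by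
        have hsub : Integrable (fun x => (1 + s ^ 2) / (2 * s) - r x / s)
            (multivariateGaussian 0 (B * B)) := (integrable_const _).sub (hI1.div_const _)
        rw [integral_add hsub (hI2.div_const _),
          integral_sub (integrable_const _) (hI1.div_const _), integral_const, integral_div,
          integral_div, hone,
          hval]
        simp
    _ ≤ (1 + s ^ 2) / (2 * s) - 1 / s + (1 + s ^ 2) / (2 * s) := by
        gcongr; linarith
    _ = s := by field_simp; ring

/-! ### Structure of the class laws -/

theorem multivariateGaussian_conv {m : ℕ} {A B : Matrix (Fin m) (Fin m) ℝ}
    (hA : A.PosSemidef) (hB : B.PosSemidef) :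
    (multivariateGaussian 0 A).conv (multivariateGaussian 0 B) =
      multivariateGaussian 0 (A + B) := by
  refine Measure.ext_of_charFun ?_
  ext t
  rw [charFun_conv, charFun_multivariateGaussian hA, charFun_multivariateGaussian hB,
    charFun_multivariateGaussian (hA.add hB), ← Complex.exp_add]
  congr 1
  simp only [inner_zero_right, add_mulVec, dotProduct_add]
  push_cast
  ring

theorem posDef_sq_smul_one {σ : ℝ} (hσ : 0 < σ) (m : ℕ) :
    (σ ^ 2 • (1 : Matrix (Fin m) (Fin m) ℝ)).PosDef :=
  PosDef.one.smul (by positivity)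

theorem posDef_blockCov {S : (i : Fin k) → Matrix (Fin (d i)) (Fin (d i)) ℝ} {σ : ℝ}
    (hS : ∀ i, (S i).PosSemidef) (hσ : 0 < σ) (i : Fin k) : (blockCov S σ i).PosDef :=
  (posDef_sq_smul_one hσ (d i)).posSemidef_add (hS i)

/-- The covariances of all blocks of a noisy feature vector of class `i`. -/
def classCov (S : (i : Fin k) → Matrix (Fin (d i)) (Fin (d i)) ℝ) (σ : ℝ) (i : Fin k) :
    (j : Fin k) → Matrix (Fin (d j)) (Fin (d j)) ℝ :=
  Function.update (fun j => σ ^ 2 • (1 : Matrix (Fin (d j)) (Fin (d j)) ℝ)) i (blockCov S σ i)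

instance isProbabilityMeasure_noiseLaw (σ : ℝ) : IsProbabilityMeasure (noiseLaw d σ) := by
  unfold noiseLaw; infer_instance

/-- For a fixed signal value the probability of a box factors over blocks and only factor `i` is
shifted; averaging over the signal turns that factor into a convolution of two Gaussians. -/
theorem classLaw_eq_pi {S : (i : Fin k) → Matrix (Fin (d i)) (Fin (d i)) ℝ} {σ : ℝ}
    (hS : ∀ i, (S i).PosSemidef) (hσ : 0 < σ) (i : Fin k) :
    classLaw S σ i = Measure.pi fun j => multivariateGaussian 0 (classCov S σ i j) := by
  symm
  refine Measure.pi_eq fun s hs => ?_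
  have hmeas : Measurable fun p : EuclideanSpace ℝ (Fin (d i)) × Features k d =>
      (Pi.single i p.1 + p.2 : Features k d) :=
    ((measurable_update (0 : Features k d) (a := i)).comp measurable_fst).add measurable_snd
  have hbox : MeasurableSet (Set.univ.pi s) := MeasurableSet.univ_pi hs
  rw [classLaw, Measure.map_apply hmeas hbox, Measure.prod_apply (hmeas hbox)]
  have hsec : ∀ a : EuclideanSpace ℝ (Fin (d i)),
      noiseLaw d σ (Prod.mk a ⁻¹' ((fun p => (Pi.single i p.1 + p.2 : Features k d)) ⁻¹'
        Set.univ.pi s)) =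
      multivariateGaussian 0 (σ ^ 2 • (1 : Matrix (Fin (d i)) (Fin (d i)) ℝ))
          ((fun y => a + y) ⁻¹' s i) *
        ∏ j ∈ Finset.univ.erase i, multivariateGaussian 0 (classCov S σ i j) (s j) := by
    intro a
    have : Prod.mk a ⁻¹' ((fun p => (Pi.single i p.1 + p.2 : Features k d)) ⁻¹' Set.univ.pi s) =
        Set.univ.pi fun j => (fun y => (Pi.single i a : Features k d) j + y) ⁻¹' s j := by
      ext e; simp [Set.mem_pi]
    rw [this, noiseLaw, Measure.pi_pi, ← Finset.mul_prod_erase _ _ (Finset.mem_univ i)]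
    congr 1
    · simp
    · refine Finset.prod_congr rfl fun j hj => ?_
      have hj' := Finset.ne_of_mem_erase hj
      simp [classCov, hj']
  simp only [hsec]
  rw [lintegral_mul_const, ← Finset.mul_prod_erase _ _ (Finset.mem_univ i)]
  · congr 1
    rw [classCov, Function.update_self, blockCov, ← multivariateGaussian_conv (hS i)
      (posDef_sq_smul_one hσ (d i)).posSemidef, Measure.conv,
      Measure.map_apply (by fun_prop) (hs i), Measure.prod_apply (by measurability)]
    rfl
  · exact measurable_measure_prodMk_left (ν := multivariateGaussian 0
      (σ ^ 2 • (1 : Matrix (Fin (d i)) (Fin (d i)) ℝ)))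
      (s := (fun p : EuclideanSpace ℝ (Fin (d i)) × EuclideanSpace ℝ (Fin (d i)) => p.1 + p.2) ⁻¹'
        s i) ((by fun_prop : Measurable _) (hs i))

theorem isProbabilityMeasure_classLaw {S : (i : Fin k) → Matrix (Fin (d i)) (Fin (d i)) ℝ}
    {σ : ℝ} (hS : ∀ i, (S i).PosSemidef) (hσ : 0 < σ) (i : Fin k) :
    IsProbabilityMeasure (classLaw S σ i) := by
  rw [classLaw_eq_pi hS hσ]; infer_instance

theorem classLaw_map_eval {S : (i : Fin k) → Matrix (Fin (d i)) (Fin (d i)) ℝ} {σ : ℝ}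
    (hS : ∀ i, (S i).PosSemidef) (hσ : 0 < σ) (i : Fin k) :
    (classLaw S σ i).map (fun x => x i) = multivariateGaussian 0 (blockCov S σ i) := by
  rw [classLaw_eq_pi hS hσ]
  have := (measurePreserving_eval
    (fun j => multivariateGaussian 0 (classCov S σ i j)) i).map_eq
  simpa [classCov] using this

/-- Both laws are products over blocks with equal factors off block `i`, so all other ratios are
`1`. -/
theorem classLaw_eq_withDensity {S : (i : Fin k) → Matrix (Fin (d i)) (Fin (d i)) ℝ} {σ : ℝ}
    (hS : ∀ i, (S i).PosSemidef) (hσ : 0 < σ) (i : Fin k) :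
    classLaw S σ i = (noiseLaw d σ).withDensity fun x =>
      ENNReal.ofReal (gaussRatio (blockCov S σ i) (σ ^ 2 • 1) (x i)) := by
  have hpd : ∀ j, (classCov S σ i j).PosDef := by
    intro j
    rcases eq_or_ne j i with rfl | hj
    · rw [classCov, Function.update_self]; exact posDef_blockCov hS hσ j
    · rw [classCov, Function.update_of_ne hj]; exact posDef_sq_smul_one hσ (d j)
  have hN := fun j => posDef_sq_smul_one hσ (d j)
  have h := pi_withDensity (fun j => multivariateGaussian 0
      (σ ^ 2 • (1 : Matrix (Fin (d j)) (Fin (d j)) ℝ)))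
    (fun j => gaussRatio (classCov S σ i j) (σ ^ 2 • 1))
    (fun j x => (gaussRatio_pos _ _ x).le)
    (fun j => (integrable_gaussRatio (hpd j) (hN j)).1)
  simp only [← multivariateGaussian_eq_withDensity_gaussRatio (hpd _) (hN _)] at h
  rw [classLaw_eq_pi hS hσ, h, noiseLaw]
  congr 1
  ext x
  congr 1
  rw [Finset.prod_eq_single i]
  · rw [classCov, Function.update_self]
  · intro j _ hj
    rw [classCov, Function.update_of_ne hj, gaussRatio, sub_self, Real.exp_zero]
  · simp

/-! ### Excess risk of the plug-in rule -/

/-- The excess risk of a plug-in classifier is at most the sum of the `L¹` errors of the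
estimated class densities. -/
theorem plugin_integral_le {Ω : Type*} [MeasurableSpace Ω] {ν : Measure Ω}
    {f q : Fin k → Ω → ℝ} (hf : ∀ i, Integrable (f i) ν) (hq : ∀ i, Integrable (q i) ν)
    {h g : Ω → Fin k} (hh : Measurable h) (hg : Measurable g)
    (hmax : ∀ x i, q i x ≤ q (h x) x) :
    ∫ x, f (g x) x ∂ν - ∫ x, f (h x) x ∂ν ≤ ∑ i, ∫ x, |f i x - q i x| ∂ν := by
  have hsel : ∀ {u : Ω → Fin k}, Measurable u → Integrable (fun x => f (u x) x) ν := by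
    intro u hu
    have : (fun x => f (u x) x) = fun x => ∑ i, (u ⁻¹' {i}).indicator (f i) x := by
      ext x
      rw [Finset.sum_eq_single (u x)]
      · simp
      · intro j _ hj; simp [hj.symm]
      · simp
    rw [this]
    exact integrable_finsetSum _ fun i _ => (hf i).indicator (hu (measurableSet_singleton i))
  have habs : ∀ i, Integrable (fun x => |f i x - q i x|) ν := fun i => ((hf i).sub (hq i)).abs
  rw [← integral_sub (hsel hg) (hsel hh), ← integral_finsetSum _ fun i _ => habs i]
  refine integral_mono ((hsel hg).sub (hsel hh))
    (integrable_finsetSum _ fun i _ => habs i) fun x => ?_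
  rcases eq_or_ne (g x) (h x) with e | e
  · simp only [e, sub_self]
    exact Finset.sum_nonneg fun i _ => abs_nonneg _
  -- Since `h x` maximizes `q`, replacing `f` by `q` costs only the errors at the two distinct
  -- classes `g x` and `h x`.
  · calc f (g x) x - f (h x) x ≤ |f (g x) x - q (g x) x| + |f (h x) x - q (h x) x| := by
          have h1 := le_abs_self (f (g x) x - q (g x) x)
          have h2 := neg_abs_le (f (h x) x - q (h x) x)
          have h3 := hmax x (g x)
          linarith
      _ = ∑ i ∈ {g x, h x}, |f i x - q i x| := by rw [Finset.sum_pair e]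
      _ ≤ ∑ i, |f i x - q i x| :=
          Finset.sum_le_univ_sum_of_nonneg fun i => abs_nonneg _

/-- The probability of a correct decision is the average of the integrals of the class densities
over their decision regions, which assemble into one integral of the density of the chosen class. -/
theorem misclassRisk_eq {S : (i : Fin k) → Matrix (Fin (d i)) (Fin (d i)) ℝ} {σ : ℝ}
    (hS : ∀ i, (S i).PosSemidef) (hσ : 0 < σ) (hk : 1 ≤ k) {h : Features k d → Fin k}
    (hh : Measurable h) :
    misclassRisk S σ h = 1 - (k : ℝ)⁻¹ *
      ∫ x, gaussRatio (blockCov S σ (h x)) (σ ^ 2 • 1) (x (h x)) ∂noiseLaw d σ := by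
  have hint : ∀ i, Integrable (fun x : Features k d =>
      gaussRatio (blockCov S σ i) (σ ^ 2 • 1) (x i)) (noiseLaw d σ) := fun i =>
    integrable_comp_eval (i := i)
      (integrable_gaussRatio (posDef_blockCov hS hσ i) (posDef_sq_smul_one hσ (d i))).1
  have hm : ∀ i, MeasurableSet {x | h x = i} := fun i => hh (measurableSet_singleton i)
  have hreal : ∀ i, (classLaw S σ i).real {x | h x ≠ i} =
      1 - ∫ x in {x | h x = i}, gaussRatio (blockCov S σ i) (σ ^ 2 • 1) (x i) ∂noiseLaw d σ := by
    intro i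
    have := isProbabilityMeasure_classLaw hS hσ i
    have hc : {x | h x ≠ i} = {x | h x = i}ᶜ := rfl
    rw [hc, measureReal_compl (hm i), probReal_univ]
    congr 1
    rw [measureReal_def, classLaw_eq_withDensity hS hσ, withDensity_apply _ (hm i),
      integral_eq_lintegral_of_nonneg_ae (ae_of_all _ fun x => (gaussRatio_pos _ _ _).le)
        (hint i).1.restrict]
  have hsum : ∑ i, ∫ x in {x | h x = i}, gaussRatio (blockCov S σ i) (σ ^ 2 • 1) (x i)
        ∂noiseLaw d σ =
      ∫ x, gaussRatio (blockCov S σ (h x)) (σ ^ 2 • 1) (x (h x)) ∂noiseLaw d σ := by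
    simp only [← integral_indicator (hm _)]
    rw [← integral_finsetSum _ fun i _ => (hint i).indicator (hm i)]
    refine integral_congr_ae (ae_of_all _ fun x => ?_)
    simp only
    rw [Finset.sum_eq_single (h x)]
    · simp
    · intro j _ hj; simp [hj.symm]
    · simp
  have hk' : (k : ℝ) ≠ 0 := by positivity
  rw [misclassRisk]
  simp only [hreal]
  rw [Finset.sum_sub_distrib, hsum, mul_sub]
  simp [hk']

/-- Factoring out the true density gives `|p - q| = p |1 - q/p|`, and weighting the noise law of the
block by `p` produces `N(0, C)`. -/
theorem integral_abs_sub_gaussRatio {σ : ℝ} (hσ : 0 < σ) (i : Fin k)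
    {A C : Matrix (Fin (d i)) (Fin (d i)) ℝ} (hC : C.PosDef) :
    ∫ x, |gaussRatio C (σ ^ 2 • 1) (x i) - gaussRatio A (σ ^ 2 • 1) (x i)| ∂noiseLaw d σ =
      ∫ x, |1 - gaussRatio A C x| ∂multivariateGaussian 0 C := by
  have hN := posDef_sq_smul_one hσ (d i)
  have hmA := measurable_gaussRatio A (σ ^ 2 • 1)
  have hmC := measurable_gaussRatio C (σ ^ 2 • 1)
  rw [multivariateGaussian_eq_withDensity_gaussRatio hC hN,
    integral_withDensity_eq_integral_toReal_smul (by fun_prop) (ae_of_all _ fun x => by simp)]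
  have he := measurePreserving_eval (fun j => multivariateGaussian 0
      (σ ^ 2 • (1 : Matrix (Fin (d j)) (Fin (d j)) ℝ))) i
  rw [← he.map_eq, integral_map he.measurable.aemeasurable]
  · refine integral_congr_ae (ae_of_all _ fun x => ?_)
    simp only [Function.eval]
    rw [ENNReal.toReal_ofReal (gaussRatio_pos _ _ _).le, smul_eq_mul,
      ← abs_of_pos (gaussRatio_pos C (σ ^ 2 • 1) (x i)), ← abs_mul,
      abs_of_pos (gaussRatio_pos C (σ ^ 2 • 1) (x i)), mul_sub, mul_one,
      mul_comm (gaussRatio C _ _), gaussRatio_mul]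
  · have := measurable_gaussRatio A C
    exact Measurable.aestronglyMeasurable (by fun_prop)

/-- The QDA router maximizes the estimated class densities relative to the noise law. -/
theorem IsQDARouter.gaussRatio_le {σ : ℝ} {n : ℕ} {Y : Fin n → Fin k} {X : Fin n → Features k d}
    {h : Features k d → Fin k} (hh : IsQDARouter σ Y X h) (x : Features k d) (i : Fin k) :
    gaussRatio (sampleCov Y X i) (σ ^ 2 • 1) (x i) ≤
      gaussRatio (sampleCov Y X (h x)) (σ ^ 2 • 1) (x (h x)) := by
  have key : ∀ i, qdaScore σ Y X i x =
      gaussScore (sampleCov Y X i) (x i) - gaussScore (σ ^ 2 • 1) (x i) +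
        ∑ j, gaussScore (σ ^ 2 • (1 : Matrix (Fin (d j)) (Fin (d j)) ℝ)) (x j) := by
    intro i
    rw [qdaScore, ← Finset.add_sum_erase _ _ (Finset.mem_univ i)]
    ring
  have := hh x i
  rw [key, key] at this
  exact Real.exp_le_exp.2 (by linarith)

/-- The excess risk of the QDA router in terms of the `L¹` errors of the block densities. -/
theorem misclassRisk_sub_optimalRisk_le {S : (i : Fin k) → Matrix (Fin (d i)) (Fin (d i)) ℝ}
    {σ : ℝ} (hS : ∀ i, (S i).PosSemidef) (hσ : 0 < σ) (hk : 1 ≤ k) {n : ℕ} {Y : Fin n → Fin k}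
    {X : Fin n → Features k d} {h : Features k d → Fin k} (hm : Measurable h)
    (hh : IsQDARouter σ Y X h) {ε : ℝ} (hpd : ∀ i, (sampleCov Y X i).PosDef)
    (hε : ∀ i, ∫ x, |1 - gaussRatio (sampleCov Y X i) (blockCov S σ i) x|
      ∂multivariateGaussian 0 (blockCov S σ i) ≤ ε) :
    misclassRisk S σ h - optimalRisk S σ ≤ ε := by
  have : Nonempty {h : Features k d → Fin k // Measurable h} :=
    ⟨fun _ => ⟨0, hk⟩, measurable_const⟩
  have hk' : (0 : ℝ) < k := by exact_mod_cast hk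
  rw [sub_le_comm, optimalRisk]
  refine le_ciInf fun g => ?_
  rw [misclassRisk_eq hS hσ hk hm, misclassRisk_eq hS hσ hk g.2]
  have hpl := plugin_integral_le (ν := noiseLaw d σ)
    (f := fun i x => gaussRatio (blockCov S σ i) (σ ^ 2 • 1) (x i))
    (q := fun i x => gaussRatio (sampleCov Y X i) (σ ^ 2 • 1) (x i))
    (fun i => integrable_comp_eval (i := i)
      (integrable_gaussRatio (posDef_blockCov hS hσ i) (posDef_sq_smul_one hσ (d i))).1)
    (fun i => integrable_comp_eval (i := i)
      (integrable_gaussRatio (hpd i) (posDef_sq_smul_one hσ (d i))).1)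
    hm g.2 hh.gaussRatio_le
  have hsum : ∑ i, ∫ x, |gaussRatio (blockCov S σ i) (σ ^ 2 • 1) (x i) -
      gaussRatio (sampleCov Y X i) (σ ^ 2 • 1) (x i)| ∂noiseLaw d σ ≤ k * ε := by
    calc _ ≤ ∑ _i : Fin k, ε := Finset.sum_le_sum fun i _ => by
          rw [integral_abs_sub_gaussRatio hσ i (posDef_blockCov hS hσ i)]; exact hε i
      _ = k * ε := by simp
  have := mul_le_mul_of_nonneg_left (hpl.trans hsum) (inv_nonneg.2 hk'.le)
  rw [inv_mul_cancel_left₀ hk'.ne', mul_sub] at this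
  linarith

theorem misclassRisk_sub_optimalRisk_le_one
    {S : (i : Fin k) → Matrix (Fin (d i)) (Fin (d i)) ℝ}
    {σ : ℝ} (hS : ∀ i, (S i).PosSemidef) (hσ : 0 < σ) (h : Features k d → Fin k) :
    misclassRisk S σ h - optimalRisk S σ ≤ 1 := by
  have h1 : misclassRisk S σ h ≤ 1 := by
    rw [misclassRisk]
    calc _ ≤ (k : ℝ)⁻¹ * ∑ _i : Fin k, (1 : ℝ) := by
          gcongr with i
          have := isProbabilityMeasure_classLaw hS hσ i
          exact measureReal_le_one
      _ ≤ 1 := by simpa using inv_mul_le_one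
  have h2 : 0 ≤ optimalRisk S σ := Real.iInf_nonneg fun g =>
    mul_nonneg (by positivity) (Finset.sum_nonneg fun i _ => measureReal_nonneg)
  linarith

/-! ### Chi-square concentration in a fixed direction -/

theorem exp_neg_sub_sq_le {u : ℝ} (hu : |u| ≤ 1 / 2) : Real.exp (-u - u ^ 2) ≤ 1 - u := by
  obtain ⟨h1, h2⟩ := abs_le.1 hu
  have h3 : 1 ≤ (1 - u) * Real.exp (u + u ^ 2) := by
    rcases le_total u 0 with h | h
    · have := Real.add_one_le_exp (u + u ^ 2)
      nlinarith [mul_nonneg (sq_nonneg u) (neg_nonneg.2 h)]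
    · have h4 := Real.quadratic_le_exp_of_nonneg (show 0 ≤ u + u ^ 2 by positivity)
      -- Twice the amount by which `(1 - u)(1 + v + v²/2)` exceeds `1`, where `v = u + u²`.
      have h5 : 0 ≤ u ^ 2 * (1 - u - u ^ 2 - u ^ 3) :=
        mul_nonneg (sq_nonneg u) (by nlinarith [mul_nonneg h h, mul_nonneg h (mul_nonneg h h)])
      nlinarith [mul_le_mul_of_nonneg_left h4 (show 0 ≤ 1 - u by linarith)]
  rw [show -u - u ^ 2 = -(u + u ^ 2) by ring, Real.exp_neg, inv_le_iff_one_le_mul₀ (Real.exp_pos _)]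
  exact h3

/-- The moment generating function of a centred chi-square variable near `0`. -/
theorem integral_exp_sq_sub_one_le {c : ℝ} (hc : |c| ≤ 1 / 4) :
    Integrable (fun x => Real.exp (c * (x ^ 2 - 1))) (gaussianReal 0 1) ∧
      ∫ x, Real.exp (c * (x ^ 2 - 1)) ∂gaussianReal 0 1 ≤ Real.exp (2 * c ^ 2) := by
  obtain ⟨h1, h2⟩ := abs_le.1 hc
  have hb : 0 < 1 / 2 - c := by linarith
  have hprod : ∀ x : ℝ, gaussianPDFReal 0 1 x • Real.exp (c * (x ^ 2 - 1)) =
      (√(2 * Real.pi))⁻¹ * Real.exp (-c) * Real.exp (-(1 / 2 - c) * x ^ 2) := by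
    intro x
    simp only [gaussianPDFReal, NNReal.coe_one, mul_one, sub_zero, smul_eq_mul]
    rw [mul_assoc, mul_assoc, ← Real.exp_add, ← Real.exp_add]
    ring_nf
  constructor
  · rw [gaussianReal_of_var_ne_zero _ one_ne_zero,
      integrable_withDensity_iff_integrable_smul' (measurable_gaussianPDF 0 1)
        (ae_of_all _ fun x => gaussianPDF_lt_top)]
    simp only [toReal_gaussianPDF, hprod]
    exact (integrable_exp_neg_mul_sq hb).const_mul _
  · rw [integral_gaussianReal_eq_integral_smul one_ne_zero]
    simp only [hprod]
    rw [integral_const_mul, integral_gaussian]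
    -- The exact value is `exp (-c) / √(1 - 2c)`; the restriction `|c| ≤ 1/4` is what puts `2c` in
    -- the range of this bound.
    have hu := exp_neg_sub_sq_le (u := 2 * c) (by rw [abs_mul, abs_two]; linarith)
    have hpos : 0 < 1 - 2 * c := by linarith
    have e1 : √(Real.pi / (1 / 2 - c)) = √(2 * Real.pi) * (√(1 - 2 * c))⁻¹ := by
      rw [← Real.sqrt_inv, ← Real.sqrt_mul (by positivity)]
      congr 1
      field_simp
    have e2 : Real.exp (-c - 2 * c ^ 2) ≤ √(1 - 2 * c) := by
      refine Real.le_sqrt_of_sq_le ?_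
      rw [← Real.exp_nat_mul]
      convert hu using 2
      push_cast; ring
    rw [e1]
    have h2pi : √(2 * Real.pi) ≠ 0 := by positivity
    have hs : 0 < √(1 - 2 * c) := Real.sqrt_pos.2 hpos
    calc _ = Real.exp (-c) * (√(1 - 2 * c))⁻¹ := by field_simp
      _ ≤ Real.exp (-c) * (Real.exp (-c - 2 * c ^ 2))⁻¹ := by gcongr
      _ = Real.exp (2 * c ^ 2) := by rw [← Real.exp_neg, ← Real.exp_add]; ring_nf

theorem multivariateGaussian_map_dotProduct {m : ℕ} {C : Matrix (Fin m) (Fin m) ℝ}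
    (hC : C.PosSemidef) (v : Fin m → ℝ) :
    (multivariateGaussian 0 C).map (fun x => v ⬝ᵥ x.ofLp) =
      gaussianReal 0 (v ⬝ᵥ C *ᵥ v).toNNReal := by
  have hL : (fun x : EuclideanSpace ℝ (Fin m) => v ⬝ᵥ x.ofLp) = innerSL ℝ (toLp 2 v) := by
    ext x
    rw [innerSL_apply_apply, EuclideanSpace.inner_eq_star_dotProduct, star_trivial,
      dotProduct_comm]
  rw [hL, IsGaussian.map_eq_gaussianReal]
  congr 1
  · rw [ContinuousLinearMap.integral_comp_id_comm IsGaussian.integrable_id,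
      integral_id_multivariateGaussian, map_zero]
  · congr 1
    have := covarianceBilin_multivariateGaussian (μ := 0) hC (toLp 2 v) (toLp 2 v)
    rw [← covariance_self (by fun_prop), ← this,
      covarianceBilin_apply_eq_cov IsGaussian.memLp_two_id]
    rfl

theorem integral_exp_sq_multivariateGaussian_le {m : ℕ} {C : Matrix (Fin m) (Fin m) ℝ}
    (hC : C.PosSemidef) {v : Fin m → ℝ} {τ c : ℝ} (hτ : v ⬝ᵥ C *ᵥ v = τ) (hτ0 : 0 ≤ τ)
    (hc : |c * τ| ≤ 1 / 4) :
    Integrable (fun x => Real.exp (c * ((v ⬝ᵥ x.ofLp) ^ 2 - τ))) (multivariateGaussian 0 C) ∧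
      ∫ x, Real.exp (c * ((v ⬝ᵥ x.ofLp) ^ 2 - τ)) ∂multivariateGaussian 0 C ≤
        Real.exp (2 * (c * τ) ^ 2) := by
  have hscale : gaussianReal 0 τ.toNNReal = (gaussianReal 0 1).map (fun x => √τ * x) := by
    rw [gaussianReal_map_const_mul]
    congr 1
    · simp
    · ext; simp [Real.sq_sqrt hτ0, hτ0]
  have hv : Measurable fun x : EuclideanSpace ℝ (Fin m) => v ⬝ᵥ x.ofLp := by
    unfold dotProduct; fun_prop
  have hlaw := multivariateGaussian_map_dotProduct hC v
  rw [hτ, hscale] at hlaw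
  have hg : Measurable fun y : ℝ => Real.exp (c * (y ^ 2 - τ)) := by fun_prop
  have hm : Measurable fun x : ℝ => √τ * x := by fun_prop
  have heq : ∀ x : ℝ, Real.exp (c * ((√τ * x) ^ 2 - τ)) = Real.exp (c * τ * (x ^ 2 - 1)) := by
    intro x
    rw [mul_pow, Real.sq_sqrt hτ0]; ring_nf
  obtain ⟨hi, hle⟩ := integral_exp_sq_sub_one_le hc
  constructor
  · have : Integrable (fun y : ℝ => Real.exp (c * (y ^ 2 - τ)))
        ((gaussianReal 0 1).map (fun x => √τ * x)) := by
      rw [integrable_map_measure hg.aestronglyMeasurable hm.aemeasurable]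
      simpa only [Function.comp_def, heq] using hi
    rw [← hlaw, integrable_map_measure hg.aestronglyMeasurable hv.aemeasurable] at this
    exact this
  · rw [← integral_map hv.aemeasurable (f := fun y : ℝ => Real.exp (c * (y ^ 2 - τ)))
      hg.aestronglyMeasurable, hlaw, integral_map hm.aemeasurable hg.aestronglyMeasurable]
    simpa only [heq] using hle

theorem dotProduct_sampleCov_mulVec {n : ℕ} (Y : Fin n → Fin k) (X : Fin n → Features k d)
    (i : Fin k) (v : Fin (d i) → ℝ) :
    v ⬝ᵥ sampleCov Y X i *ᵥ v =
      (classCount Y i : ℝ)⁻¹ *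
        ∑ j ∈ Finset.univ.filter (fun j => Y j = i), (v ⬝ᵥ (X j i).ofLp) ^ 2 := by
  have h : sampleCov Y X i = (classCount Y i : ℝ)⁻¹ •
      ∑ j ∈ Finset.univ.filter (fun j => Y j = i), vecMulVec (X j i).ofLp (X j i).ofLp := by
    ext a b
    simp [sampleCov, Matrix.sum_apply, vecMulVec_apply]
  rw [h, smul_mulVec, dotProduct_smul, sum_mulVec, dotProduct_sum, smul_eq_mul]
  congr 1
  refine Finset.sum_congr rfl fun j _ => ?_
  rw [vecMulVec_mulVec, dotProduct_smul, dotProduct_comm (X j i).ofLp v]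
  simp [sq]

/-- Chernoff bound for the sample variance in a fixed direction. -/
theorem trainingLaw_sampleCov_tail {S : (i : Fin k) → Matrix (Fin (d i)) (Fin (d i)) ℝ} {σ : ℝ}
    (hS : ∀ i, (S i).PosSemidef) (hσ : 0 < σ) {n : ℕ} (Y : Fin n → Fin k) (i : Fin k)
    (hn : 0 < classCount Y i) (v : Fin (d i) → ℝ) {s : ℝ} (hs : 0 < s) (hs1 : s ≤ 1) :
    (trainingLaw S σ Y).real {X | s * (v ⬝ᵥ blockCov S σ i *ᵥ v) <
      |v ⬝ᵥ sampleCov Y X i *ᵥ v - v ⬝ᵥ blockCov S σ i *ᵥ v|} ≤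
      2 * Real.exp (-(classCount Y i * s ^ 2 / 8)) := by
  have hC := posDef_blockCov hS hσ i
  have hprob := fun j => isProbabilityMeasure_classLaw hS hσ (Y j)
  have hprobT : IsProbabilityMeasure (trainingLaw S σ Y) := by
    unfold trainingLaw; infer_instance
  -- The zero direction does occur, as a difference of equal net points; the strict inequality makes
  -- its bad event empty.
  rcases eq_or_ne v 0 with rfl | hv
  · simp only [zero_dotProduct, mul_zero, sub_self, abs_zero, lt_self_iff_false, Set.ofPred_false,
      measureReal_empty]
    positivity
  set τ := v ⬝ᵥ blockCov S σ i *ᵥ v with hτ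
  have hτ0 : 0 < τ := by simpa using hC.dotProduct_mulVec_pos hv
  set N : ℝ := (classCount Y i : ℝ) with hN
  have hN0 : 0 < N := by rw [hN]; exact_mod_cast hn
  set Q : (Fin n → Features k d) → ℝ := fun X =>
    ∑ j ∈ Finset.univ.filter (fun j => Y j = i), ((v ⬝ᵥ (X j i).ofLp) ^ 2 - τ) with hQ
  have hQeq : ∀ X, v ⬝ᵥ sampleCov Y X i *ᵥ v - τ = Q X / N := by
    intro X
    rw [dotProduct_sampleCov_mulVec, hQ]
    simp only [Finset.sum_sub_distrib, Finset.sum_const, nsmul_eq_mul]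
    change _ = (_ - (classCount Y i : ℝ) * τ) / N
    rw [← hN]; field_simp
  have hmgf : ∀ c : ℝ, |c * τ| ≤ 1 / 4 →
      Integrable (fun X => Real.exp (c * Q X)) (trainingLaw S σ Y) ∧
        mgf Q (trainingLaw S σ Y) c ≤ Real.exp (2 * (c * τ) ^ 2 * N) := by
    intro c hc
    obtain ⟨hi, hle⟩ := integral_exp_sq_multivariateGaussian_le hC.posSemidef hτ.symm hτ0.le hc
    -- Rows of other classes get the factor `1`, so the exponential factors over all independent
    -- rows.
    set g : Fin n → Features k d → ℝ := fun j x =>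
      if Y j = i then Real.exp (c * ((v ⬝ᵥ (x i).ofLp) ^ 2 - τ)) else 1 with hg
    have hprod : ∀ X, Real.exp (c * Q X) = ∏ j, g j (X j) := by
      intro X
      rw [hQ, Finset.mul_sum, Real.exp_sum, Finset.prod_filter]
    have hgm : Measurable fun x : EuclideanSpace ℝ (Fin (d i)) =>
        Real.exp (c * ((v ⬝ᵥ x.ofLp) ^ 2 - τ)) := by
      unfold dotProduct; fun_prop
    have hev : Measurable fun x : Features k d => x i := measurable_pi_apply i
    have hgi : ∀ j, Integrable (g j) (classLaw S σ (Y j)) := by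
      intro j
      by_cases hj : Y j = i
      · simp only [hg, hj, if_true]
        rw [← classLaw_map_eval hS hσ i,
          integrable_map_measure hgm.aestronglyMeasurable hev.aemeasurable] at hi
        exact hi
      · simp only [hg, hj, if_false]
        exact integrable_const _
    have hgle : ∀ j, ∫ x, g j x ∂classLaw S σ (Y j) ≤
        if Y j = i then Real.exp (2 * (c * τ) ^ 2) else 1 := by
      intro j
      by_cases hj : Y j = i
      · simp only [hg, hj, if_true]
        rw [← classLaw_map_eval hS hσ i, integral_map hev.aemeasurable
          hgm.aestronglyMeasurable] at hle
        exact hle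
      · simp [hg, hj]
    simp only [mgf, hprod]
    refine ⟨Integrable.fintype_prod_dep hgi, ?_⟩
    rw [trainingLaw, integral_fintype_prod_eq_prod]
    calc _ ≤ ∏ j, (if Y j = i then Real.exp (2 * (c * τ) ^ 2) else 1) :=
          Finset.prod_le_prod (fun j _ => integral_nonneg fun x => by
            simp only [hg, Pi.zero_apply]; split_ifs <;> positivity) fun j _ => hgle j
      _ = Real.exp (2 * (c * τ) ^ 2 * N) := by
          rw [← Finset.prod_filter, Finset.prod_const, ← Real.exp_nat_mul, mul_comm, hN,
            classCount]
  -- The parameter `s / (4τ)` minimizes the Chernoff exponent `-c N s τ + 2 c² τ² N`, with value `-N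
  -- s² / 8`; `s ≤ 1` keeps it admissible.
  have hcτ : s / (4 * τ) * τ = s / 4 := by field_simp
  obtain ⟨hiu, hmu⟩ := hmgf (s / (4 * τ)) (by rw [hcτ, abs_of_pos (by positivity)]; linarith)
  obtain ⟨hil, hml⟩ := hmgf (-(s / (4 * τ)))
    (by rw [neg_mul, hcτ, abs_neg, abs_of_pos (by positivity)]; linarith)
  have hup := measure_ge_le_exp_mul_mgf (N * s * τ) (by positivity) hiu
  have hlo := measure_le_le_exp_mul_mgf (-(N * s * τ)) (by simp; positivity) hil
  have hexp : Real.exp (-(s / (4 * τ)) * (N * s * τ)) * Real.exp (2 * (s / 4) ^ 2 * N) =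
      Real.exp (-(N * s ^ 2 / 8)) := by
    rw [← Real.exp_add]; congr 1; field_simp; ring
  rw [hcτ] at hmu
  rw [neg_mul, hcτ, neg_sq] at hml
  have hup' := hup.trans (mul_le_mul_of_nonneg_left hmu (Real.exp_pos _).le)
  have hlo' := hlo.trans (mul_le_mul_of_nonneg_left hml (Real.exp_pos _).le)
  rw [hexp] at hup'
  rw [show - -(s / (4 * τ)) * -(N * s * τ) = -(s / (4 * τ)) * (N * s * τ) by ring, hexp] at hlo'
  calc _ ≤ (trainingLaw S σ Y).real ({X | N * s * τ ≤ Q X} ∪ {X | Q X ≤ -(N * s * τ)}) := by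
        refine measureReal_mono fun X hX => ?_
        simp only [Set.mem_ofPred_eq, hQeq, abs_div, abs_of_pos hN0, lt_div_iff₀ hN0] at hX
        rcases lt_abs.1 hX with h | h
        · left; simp only [Set.mem_ofPred_eq]; linarith
        · right; simp only [Set.mem_ofPred_eq]; linarith
    _ ≤ _ := measureReal_union_le _ _
    _ ≤ _ := by linarith

/-! ### Nets and operator norms -/

/-- The unit ball of a normed space of dimension `m` has a `1/2`-net of at most `5 ^ m` points. -/
theorem exists_half_net (E : Type*) [NormedAddCommGroup E] [NormedSpace ℝ E]
    [FiniteDimensional ℝ E] :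
    ∃ N : Finset E, N.card ≤ 5 ^ Module.finrank ℝ E ∧ (∀ y ∈ N, ‖y‖ ≤ 1) ∧
      ∀ x : E, ‖x‖ ≤ 1 → ∃ y ∈ N, ‖x - y‖ ≤ 1 / 2 := by
  classical
  set P : Finset E → Prop := fun s => (∀ c ∈ s, ‖c‖ ≤ 2) ∧
    ∀ c ∈ s, ∀ e ∈ s, c ≠ e → 1 ≤ ‖c - e‖ with hP
  set T : Set ℕ := {n | ∃ s, P s ∧ s.card = n} with hT
  have hbdd : BddAbove T := ⟨5 ^ Module.finrank ℝ E, by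
    rintro _ ⟨s, hs, rfl⟩
    exact Besicovitch.card_le_of_separated s hs.1 hs.2⟩
  -- A `1`-separated subset of the ball of radius `2` of maximal cardinality is a `1`-net there;
  -- halving it gives the required net.
  obtain ⟨s, hs, hcard⟩ : sSup T ∈ T := Nat.sSup_mem ⟨0, ∅, by simp [hP], rfl⟩ hbdd
  have hcover : ∀ x : E, ‖x‖ ≤ 2 → ∃ c ∈ s, ‖x - c‖ ≤ 1 := by
    intro x hx
    by_contra! h
    have hxs : x ∉ s := fun hxs => by simpa using (h x hxs).le.trans_lt' zero_lt_one
    have hins : P (insert x s) := by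
      refine ⟨fun c hc => ?_, fun c hc e he hce => ?_⟩
      · rcases Finset.mem_insert.1 hc with rfl | hc
        exacts [hx, hs.1 c hc]
      · rcases Finset.mem_insert.1 hc with rfl | hc'
        · rcases Finset.mem_insert.1 he with rfl | he'
          · exact absurd rfl hce
          · exact (h e he').le
        · rcases Finset.mem_insert.1 he with rfl | he'
          · rw [norm_sub_rev]; exact (h c hc').le
          · exact hs.2 c hc' e he' hce
    have := le_csSup hbdd ⟨insert x s, hins, rfl⟩
    rw [Finset.card_insert_of_notMem hxs] at this
    omega
  refine ⟨s.image fun c => (1 / 2 : ℝ) • c,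
    Finset.card_image_le.trans (Besicovitch.card_le_of_separated s hs.1 hs.2), ?_, ?_⟩
  · intro y hy
    obtain ⟨c, hc, rfl⟩ := Finset.mem_image.1 hy
    rw [norm_smul, Real.norm_of_nonneg (by norm_num)]
    linarith [hs.1 c hc]
  · intro x hx
    obtain ⟨c, hc, hxc⟩ := hcover ((2 : ℝ) • x) (by
      rw [norm_smul, Real.norm_of_nonneg (by norm_num)]; linarith)
    refine ⟨_, Finset.mem_image_of_mem _ hc, ?_⟩
    rw [show x - (1 / 2 : ℝ) • c = (1 / 2 : ℝ) • ((2 : ℝ) • x - c) by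
      rw [smul_sub, smul_smul]; norm_num, norm_smul, Real.norm_of_nonneg (by norm_num)]
    linarith

/-- The operator norm is controlled by the bilinear form on a `1/2`-net of the unit ball. -/
theorem opNorm_le_of_half_net {E : Type*} [NormedAddCommGroup E] [InnerProductSpace ℝ E]
    {N : Finset E} (hN : ∀ x : E, ‖x‖ ≤ 1 → ∃ y ∈ N, ‖x - y‖ ≤ 1 / 2) (T : E →L[ℝ] E) {t : ℝ}
    (ht : ∀ y ∈ N, ∀ z ∈ N, |⟪y, T z⟫| ≤ t) : ‖T‖ ≤ 4 * t := by
  have ht0 : 0 ≤ t := by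
    obtain ⟨y, hy, -⟩ := hN 0 (by simp)
    exact (abs_nonneg _).trans (ht y hy y hy)
  -- Approximating the unit vector along `T z` by a net point gives `‖T z‖ ≤ t + ‖T z‖ / 2`; the
  -- same absorption in the argument `x` costs the second factor `2`.
  have hz : ∀ z ∈ N, ‖T z‖ ≤ 2 * t := by
    intro z hzN
    rcases eq_or_ne (T z) 0 with h0 | h0
    · rw [h0, norm_zero]; positivity
    · have hpos : 0 < ‖T z‖ := norm_pos_iff.2 h0
      obtain ⟨y, hy, hey⟩ := hN (‖T z‖⁻¹ • T z) (by
        rw [norm_smul, norm_inv, norm_norm, inv_mul_cancel₀ hpos.ne'])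
      have h1 : ⟪‖T z‖⁻¹ • T z, T z⟫ = ‖T z‖ := by
        rw [real_inner_smul_left, real_inner_self_eq_norm_sq]; field_simp
      have h2 : ⟪‖T z‖⁻¹ • T z, T z⟫ = ⟪y, T z⟫ + ⟪‖T z‖⁻¹ • T z - y, T z⟫ := by
        rw [inner_sub_left]; ring
      have h3 := (real_inner_le_norm (‖T z‖⁻¹ • T z - y) (T z)).trans
        (mul_le_mul_of_nonneg_right hey hpos.le)
      have h4 := (le_abs_self _).trans (ht y hy z hzN)
      linarith
  have hT : ‖T‖ ≤ 2 * t + ‖T‖ * (1 / 2) := by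
    refine T.opNorm_le_of_unit_norm (by positivity) fun x hx => ?_
    obtain ⟨z, hzN, hxz⟩ := hN x hx.le
    calc ‖T x‖ = ‖T z + T (x - z)‖ := by rw [← map_add]; congr 2; abel
      _ ≤ ‖T z‖ + ‖T (x - z)‖ := norm_add_le _ _
      _ ≤ 2 * t + ‖T‖ * (1 / 2) := add_le_add (hz z hzN)
          ((T.le_opNorm _).trans (mul_le_mul_of_nonneg_left hxz (norm_nonneg _)))
  linarith

/-- A symmetric matrix whose quadratic form is small on sums and differences of net points has
small operator norm. -/
theorem norm_toEuclideanCLM_le_of_half_net {m : ℕ} {A : Matrix (Fin m) (Fin m) ℝ}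
    (hA : A.IsHermitian) {N : Finset (EuclideanSpace ℝ (Fin m))} (hN1 : ∀ y ∈ N, ‖y‖ ≤ 1)
    (hN : ∀ x : EuclideanSpace ℝ (Fin m), ‖x‖ ≤ 1 → ∃ y ∈ N, ‖x - y‖ ≤ 1 / 2) {s : ℝ}
    (hs : 0 ≤ s)
    (hq : ∀ y ∈ N, ∀ z ∈ N, |(y + z).ofLp ⬝ᵥ A *ᵥ (y + z).ofLp| ≤ s * ‖y + z‖ ^ 2 ∧
      |(y - z).ofLp ⬝ᵥ A *ᵥ (y - z).ofLp| ≤ s * ‖y - z‖ ^ 2) :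
    ‖toEuclideanCLM (𝕜 := ℝ) A‖ ≤ 4 * s := by
  refine opNorm_le_of_half_net hN _ fun y hy z hz => ?_
  obtain ⟨h1, h2⟩ := hq y hy z hz
  rw [inner_toEuclideanCLM]
  have hsymm : z.ofLp ⬝ᵥ A *ᵥ y.ofLp = y.ofLp ⬝ᵥ A *ᵥ z.ofLp := by
    rw [← mulVec_dotProduct hA, dotProduct_comm]
  -- Polarization reduces the bilinear form to quadratic forms; by the parallelogram law the two
  -- bounds add up to at most `4 s`.
  have hpol : (y + z).ofLp ⬝ᵥ A *ᵥ (y + z).ofLp - (y - z).ofLp ⬝ᵥ A *ᵥ (y - z).ofLp =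
      4 * (y.ofLp ⬝ᵥ A *ᵥ z.ofLp) := by
    simp only [ofLp_add, ofLp_sub, mulVec_add, mulVec_sub, dotProduct_add, dotProduct_sub,
      add_dotProduct, sub_dotProduct, hsymm]
    ring
  have hpar := parallelogram_law_with_norm ℝ y z
  have hy1 := pow_le_one₀ (n := 2) (norm_nonneg y) (hN1 y hy)
  have hz1 := pow_le_one₀ (n := 2) (norm_nonneg z) (hN1 z hz)
  have hle : s * ‖y + z‖ ^ 2 + s * ‖y - z‖ ^ 2 ≤ s * 4 := by
    rw [← mul_add]
    exact mul_le_mul_of_nonneg_left (by nlinarith) hs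
  have := abs_sub ((y + z).ofLp ⬝ᵥ A *ᵥ (y + z).ofLp) ((y - z).ofLp ⬝ᵥ A *ᵥ (y - z).ofLp)
  rw [hpol, abs_mul, abs_of_pos (by norm_num : (0 : ℝ) < 4)] at this
  linarith

/-! ### Concentration of the whitened sample covariance -/

/-- The whitened error of the sample covariance of block `i`. -/
def whitenedError (S : (i : Fin k) → Matrix (Fin (d i)) (Fin (d i)) ℝ) (σ : ℝ) {n : ℕ}
    (Y : Fin n → Fin k) (X : Fin n → Features k d) (i : Fin k) :
    Matrix (Fin (d i)) (Fin (d i)) ℝ :=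
  (CFC.sqrt (blockCov S σ i))⁻¹ * sampleCov Y X i * (CFC.sqrt (blockCov S σ i))⁻¹ - 1

theorem isHermitian_sampleCov {n : ℕ} (Y : Fin n → Fin k) (X : Fin n → Features k d)
    (i : Fin k) : (sampleCov Y X i).IsHermitian := by
  ext a b
  simp [sampleCov, mul_comm]

theorem isHermitian_whitenedError {S : (i : Fin k) → Matrix (Fin (d i)) (Fin (d i)) ℝ} {σ : ℝ}
    (hS : ∀ i, (S i).PosSemidef) (hσ : 0 < σ) {n : ℕ}
    (Y : Fin n → Fin k) (X : Fin n → Features k d) (i : Fin k) :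
    (whitenedError S σ Y X i).IsHermitian := by
  have hB := (posDef_sqrt (posDef_blockCov hS hσ i)).1.isHermitian.inv
  refine IsHermitian.sub ?_ isHermitian_one
  rw [IsHermitian, conjTranspose_mul, conjTranspose_mul, hB.eq, (isHermitian_sampleCov Y X i).eq,
    Matrix.mul_assoc]

/-- The substitution `v = C^{-1/2} w` turns the relative error of the sample variance along `v` into
a quadratic form of the whitened error at `w`. -/
theorem dotProduct_whitenedError_mulVec {S : (i : Fin k) → Matrix (Fin (d i)) (Fin (d i)) ℝ}
    {σ : ℝ} (hS : ∀ i, (S i).PosSemidef) (hσ : 0 < σ) {n : ℕ}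
    (Y : Fin n → Fin k) (X : Fin n → Features k d) (i : Fin k) (w : Fin (d i) → ℝ) :
    (((CFC.sqrt (blockCov S σ i))⁻¹ *ᵥ w) ⬝ᵥ
      blockCov S σ i *ᵥ ((CFC.sqrt (blockCov S σ i))⁻¹ *ᵥ w)) = w ⬝ᵥ w ∧
    w ⬝ᵥ whitenedError S σ Y X i *ᵥ w =
      ((CFC.sqrt (blockCov S σ i))⁻¹ *ᵥ w) ⬝ᵥ
        sampleCov Y X i *ᵥ ((CFC.sqrt (blockCov S σ i))⁻¹ *ᵥ w) -
      ((CFC.sqrt (blockCov S σ i))⁻¹ *ᵥ w) ⬝ᵥ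
        blockCov S σ i *ᵥ ((CFC.sqrt (blockCov S σ i))⁻¹ *ᵥ w) := by
  obtain ⟨hB, hBC⟩ := posDef_sqrt (posDef_blockCov hS hσ i)
  unfold whitenedError
  set B := CFC.sqrt (blockCov S σ i)
  have hu : IsUnit B.det := hB.det_pos.ne'.isUnit
  have h1 : (B⁻¹ *ᵥ w) ⬝ᵥ blockCov S σ i *ᵥ (B⁻¹ *ᵥ w) = w ⬝ᵥ w := by
    rw [← hBC, mulVec_dotProduct hB.isHermitian.inv, mulVec_mulVec, mulVec_mulVec,
      nonsing_inv_mul_cancel_left _ _ hu, mul_nonsing_inv _ hu, one_mulVec]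
  refine ⟨h1, ?_⟩
  rw [h1, sub_mulVec, one_mulVec, dotProduct_sub, mulVec_dotProduct hB.isHermitian.inv,
    mulVec_mulVec, mulVec_mulVec]

/-- Operator-norm concentration of the whitened sample covariance. -/
theorem trainingLaw_whitenedError_tail {S : (i : Fin k) → Matrix (Fin (d i)) (Fin (d i)) ℝ}
    {σ : ℝ} (hS : ∀ i, (S i).PosSemidef) (hσ : 0 < σ) {n : ℕ} (Y : Fin n → Fin k) (i : Fin k)
    (hn : 0 < classCount Y i) {s : ℝ} (hs : 0 < s) (hs1 : s ≤ 1) :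
    (trainingLaw S σ Y).real {X | 4 * s < ‖toEuclideanCLM (𝕜 := ℝ) (whitenedError S σ Y X i)‖} ≤
      4 * 25 ^ d i * Real.exp (-(classCount Y i * s ^ 2 / 8)) := by
  classical
  have hprob := fun j => isProbabilityMeasure_classLaw hS hσ (Y j)
  have hprobT : IsProbabilityMeasure (trainingLaw S σ Y) := by
    unfold trainingLaw; infer_instance
  obtain ⟨N, hcard, hN1, hN⟩ := exists_half_net (EuclideanSpace ℝ (Fin (d i)))
  rw [finrank_euclideanSpace_fin] at hcard
  -- The directions polarization needs: at most `2 · 25^{d_i}` of them, each with a two-sided tail,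
  -- whence the prefactor `4 · 25^{d_i}`.
  set W := (N ×ˢ N).image (fun p => p.1 + p.2) ∪ (N ×ˢ N).image (fun p => p.1 - p.2) with hW
  have hNN : (N ×ˢ N).card ≤ 25 ^ d i := by
    rw [Finset.card_product, show 25 = 5 * 5 by rfl, mul_pow]
    exact Nat.mul_le_mul hcard hcard
  have hWcard : (W.card : ℝ) ≤ 2 * 25 ^ d i := by
    have h1 : W.card ≤ 2 * 25 ^ d i := by
      refine (Finset.card_union_le _ _).trans ?_
      rw [two_mul]
      exact add_le_add (Finset.card_image_le.trans hNN) (Finset.card_image_le.trans hNN)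
    exact_mod_cast h1
  set bad : EuclideanSpace ℝ (Fin (d i)) → Set (Fin n → Features k d) := fun w =>
    {X | s * (((CFC.sqrt (blockCov S σ i))⁻¹ *ᵥ w.ofLp) ⬝ᵥ
        blockCov S σ i *ᵥ ((CFC.sqrt (blockCov S σ i))⁻¹ *ᵥ w.ofLp)) <
      |((CFC.sqrt (blockCov S σ i))⁻¹ *ᵥ w.ofLp) ⬝ᵥ
        sampleCov Y X i *ᵥ ((CFC.sqrt (blockCov S σ i))⁻¹ *ᵥ w.ofLp) -
      ((CFC.sqrt (blockCov S σ i))⁻¹ *ᵥ w.ofLp) ⬝ᵥ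
        blockCov S σ i *ᵥ ((CFC.sqrt (blockCov S σ i))⁻¹ *ᵥ w.ofLp)|} with hbad
  have hsub : {X | 4 * s < ‖toEuclideanCLM (𝕜 := ℝ) (whitenedError S σ Y X i)‖} ⊆
      ⋃ w ∈ W, bad w := by
    intro X hX
    by_contra hno
    simp only [Set.mem_iUnion, not_exists] at hno
    refine absurd (Set.mem_ofPred_eq ▸ hX) (not_lt.2 ?_)
    have hgood : ∀ w ∈ W, |w.ofLp ⬝ᵥ whitenedError S σ Y X i *ᵥ w.ofLp| ≤ s * ‖w‖ ^ 2 := by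
      intro w hw
      obtain ⟨e1, e2⟩ := dotProduct_whitenedError_mulVec hS hσ Y X i w.ofLp
      have := hno w hw
      rwa [hbad, Set.mem_ofPred_eq, not_lt, ← e2, e1, ← norm_sq_eq_dotProduct] at this
    refine norm_toEuclideanCLM_le_of_half_net (isHermitian_whitenedError hS hσ Y X i) hN1 hN hs.le
      fun y hy z hz => ⟨hgood _ ?_, hgood _ ?_⟩
    · exact Finset.mem_union_left _ (Finset.mem_image.2 ⟨(y, z), Finset.mk_mem_product hy hz, rfl⟩)
    · exact Finset.mem_union_right _ (Finset.mem_image.2 ⟨(y, z), Finset.mk_mem_product hy hz, rfl⟩)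
  calc _ ≤ (trainingLaw S σ Y).real (⋃ w ∈ W, bad w) := measureReal_mono hsub (measure_ne_top _ _)
    _ ≤ ∑ w ∈ W, (trainingLaw S σ Y).real (bad w) := measureReal_biUnion_finset_le _ _
    _ ≤ ∑ _w ∈ W, 2 * Real.exp (-(classCount Y i * s ^ 2 / 8)) :=
        Finset.sum_le_sum fun w _ => trainingLaw_sampleCov_tail hS hσ Y i hn _ hs hs1
    _ = W.card * (2 * Real.exp (-(classCount Y i * s ^ 2 / 8))) := by simp
    _ ≤ 2 * 25 ^ d i * (2 * Real.exp (-(classCount Y i * s ^ 2 / 8))) := by gcongr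
    _ = _ := by ring

/-! ### Sample size and conclusion -/

theorem sq_le_maxCovNorm {S : (i : Fin k) → Matrix (Fin (d i)) (Fin (d i)) ℝ} {σ : ℝ}
    (hS : ∀ i, (S i).PosSemidef) (i : Fin k) (hd : 1 ≤ d i) : σ ^ 2 ≤ maxCovNorm S σ := by
  refine le_trans ?_ (le_ciSup (f := fun i => ‖toEuclideanCLM (𝕜 := ℝ) (blockCov S σ i)‖)
    (Set.finite_range _).bddAbove i)
  set x : EuclideanSpace ℝ (Fin (d i)) := EuclideanSpace.single ⟨0, hd⟩ 1 with hx
  have h := (abs_le.1 (dotProduct_mulVec_le (A := blockCov S σ i) le_rfl x)).2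
  have hn : ‖x‖ ^ 2 = 1 := by simp [hx]
  have h1 : x.ofLp ⬝ᵥ blockCov S σ i *ᵥ x.ofLp = x.ofLp ⬝ᵥ S i *ᵥ x.ofLp + σ ^ 2 * ‖x‖ ^ 2 := by
    rw [norm_sq_eq_dotProduct, blockCov, add_mulVec, dotProduct_add, smul_mulVec, one_mulVec,
      dotProduct_smul, smul_eq_mul]
  have h2 : 0 ≤ x.ofLp ⬝ᵥ S i *ᵥ x.ofLp := by
    simpa using (hS i).dotProduct_mulVec_nonneg x.ofLp
  rw [h1, hn] at h
  linarith

/-- Sample size at which the tail bound for the whitened error drops below `δ / k`. -/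
theorem tail_le_of_sample_size {m : ℕ} {K δ ε N : ℝ} (hm : 1 ≤ m) (hK : 0 < K) (hδ : 0 < δ)
    (hN : 2048 * m * max (m : ℝ) (Real.log (K / δ)) ≤ ε ^ 2 * N) :
    4 * 25 ^ m * Real.exp (-(N * (ε ^ 2 / (32 * m)) / 8)) ≤ δ / K := by
  set L := max (m : ℝ) (Real.log (K / δ)) with hL
  have hm0 : (0 : ℝ) < m := by exact_mod_cast hm
  have h1 : 8 * L ≤ N * (ε ^ 2 / (32 * m)) / 8 := by
    rw [← mul_div_assoc, div_div, le_div_iff₀ (by positivity)]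
    linarith
  -- The net costs at most `100^m ≤ e^{7m}`, as `2^7 = 128`; of the `8 L` in the exponent one `L`
  -- survives for the confidence.
  have h2 : (4 * 25 ^ m : ℝ) ≤ Real.exp (7 * L) := by
    have h4 : (4 : ℝ) ≤ 4 ^ m := le_self_pow₀ (by norm_num) (by omega)
    have he : (100 : ℝ) ≤ Real.exp 7 := by
      have := pow_le_pow_left₀ (by norm_num) Real.exp_one_gt_two.le 7
      rw [← Real.exp_nat_mul] at this
      norm_num at this ⊢
      linarith
    calc (4 * 25 ^ m : ℝ) ≤ 4 ^ m * 25 ^ m := by gcongr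
      _ = 100 ^ m := by rw [← mul_pow]; norm_num
      _ ≤ Real.exp 7 ^ m := by gcongr
      _ = Real.exp (7 * m) := by rw [← Real.exp_nat_mul, mul_comm]
      _ ≤ Real.exp (7 * L) := Real.exp_le_exp.2 (by linarith [le_max_left (m : ℝ) (Real.log (K / δ))])
  calc _ ≤ Real.exp (7 * L) * Real.exp (-(8 * L)) := by gcongr
    _ = Real.exp (-L) := by rw [← Real.exp_add]; ring_nf
    _ ≤ Real.exp (-Real.log (K / δ)) := Real.exp_le_exp.2 (neg_le_neg (le_max_right _ _))
    _ = δ / K := by rw [Real.exp_neg, Real.exp_log (by positivity), inv_div]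

theorem sample_size_le_mul_classCount {n : ℕ} {Y : Fin n → Fin k} {ρ : ℝ}
    (hY : ∀ i j, (classCount Y i : ℝ) ≤ ρ * classCount Y j) (i : Fin k) :
    (n : ℝ) ≤ k * (ρ * classCount Y i) := by
  have h : n = ∑ j, classCount Y j := by
    have := Finset.card_eq_sum_card_fiberwise (s := Finset.univ) (t := Finset.univ) (f := Y)
      (fun _ _ => by simp)
    simpa [classCount] using this
  calc (n : ℝ) = ∑ j, (classCount Y j : ℝ) := by exact_mod_cast h
    _ ≤ ∑ _j : Fin k, ρ * classCount Y i := Finset.sum_le_sum fun j _ => hY j i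
    _ = _ := by simp

/-- On the event that all whitened errors are small, the QDA router is nearly optimal. -/
theorem excess_risk_le_of_whitenedError {S : (i : Fin k) → Matrix (Fin (d i)) (Fin (d i)) ℝ}
    {σ : ℝ} (hS : ∀ i, (S i).PosSemidef) (hσ : 0 < σ) (hk : 1 ≤ k) (hd : ∀ i, 1 ≤ d i) {n : ℕ}
    {Y : Fin n → Fin k} {X : Fin n → Features k d} {h : Features k d → Fin k} (hm : Measurable h)
    (hh : IsQDARouter σ Y X h) {ε : ℝ} (hε : 0 < ε) (hε1 : ε ≤ 1) {s : Fin k → ℝ}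
    (hs : ∀ i, s i ^ 2 = ε ^ 2 / (32 * d i))
    (hX : ∀ i, ‖toEuclideanCLM (𝕜 := ℝ) (whitenedError S σ Y X i)‖ ≤ 4 * s i) :
    misclassRisk S σ h - optimalRisk S σ ≤ ε := by
  have hblock : ∀ i, (sampleCov Y X i).PosDef ∧
      ∫ x, |1 - gaussRatio (sampleCov Y X i) (blockCov S σ i) x|
        ∂multivariateGaussian 0 (blockCov S σ i) ≤ ε := by
    intro i
    obtain ⟨hB, hBC⟩ := posDef_sqrt (posDef_blockCov hS hσ i)
    have hd0 : (1 : ℝ) ≤ d i := by exact_mod_cast hd i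
    -- The `32` in `s i` is `2 · 4²`: this value is at most both `ε²` and `1/2`, as the `L¹` bound
    -- requires.
    have hη : (d i : ℝ) * (4 * s i) ^ 2 = ε ^ 2 / 2 := by
      rw [mul_pow, hs i]; field_simp; norm_num
    have hε2 : ε ^ 2 ≤ 1 := pow_le_one₀ hε.le hε1
    have hlt : 4 * s i < 1 := by
      have h1 : (4 * s i) ^ 2 ≤ (d i : ℝ) * (4 * s i) ^ 2 :=
        le_mul_of_one_le_left (sq_nonneg _) hd0
      nlinarith
    obtain ⟨h1, h2⟩ := integral_abs_one_sub_gaussRatio_le hB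
      (isHermitian_whitenedError hS hσ Y X i) (hX i) hlt hε (by rw [hη]; nlinarith)
      (by rw [hη]; linarith)
    have hu : IsUnit (CFC.sqrt (blockCov S σ i)).det := hB.det_pos.ne'.isUnit
    have hback : CFC.sqrt (blockCov S σ i) * (1 + whitenedError S σ Y X i) *
        CFC.sqrt (blockCov S σ i) = sampleCov Y X i := by
      rw [whitenedError, add_sub_cancel, Matrix.mul_assoc, Matrix.mul_assoc, Matrix.mul_assoc,
        nonsing_inv_mul _ hu, Matrix.mul_one, mul_nonsing_inv_cancel_left _ _ hu]
    rw [hback] at h1 h2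
    rw [hBC] at h2
    exact ⟨h1, h2⟩
  exact misclassRisk_sub_optimalRisk_le hS hσ hk hm hh (fun i => (hblock i).1)
    fun i => (hblock i).2

end BlockQDA

end

open BlockQDA in
theorem theorem1 :
    ∃ c : ℝ, 0 < c ∧
      ∀ (k : ℕ) (d : Fin k → ℕ) (σ ρ : ℝ), 1 ≤ k → (∀ i, 1 ≤ d i) → 0 < σ → 1 ≤ ρ →
        ∃ C : ℝ, 0 < C ∧ C ≤ c * (ρ * k * (Finset.univ.sup d : ℕ) / σ ^ 4) ∧
          ∀ S : (i : Fin k) → Matrix (Fin (d i)) (Fin (d i)) ℝ, (∀ i, (S i).PosSemidef) →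
          ∀ (n : ℕ) (Y : Fin n → Fin k),
            (∀ i j, (BlockQDA.classCount Y i : ℝ) ≤ ρ * BlockQDA.classCount Y j) →
          ∀ router : (Fin n → BlockQDA.Features k d) → BlockQDA.Features k d → Fin k,
            Measurable (Function.uncurry router) →
            (∀ X, BlockQDA.IsQDARouter σ Y X (router X)) →
          ∀ ε δ : ℝ, 0 < ε → 0 < δ → δ < 1 →
            (n : ℝ) ≥ C * (BlockQDA.maxCovNorm S σ ^ 2 / ε ^ 2) *
              ∑ i, max (d i : ℝ) (Real.log (k / δ)) →
            BlockQDA.trainingLaw S σ Y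
                {X | BlockQDA.misclassRisk S σ (router X) - BlockQDA.optimalRisk S σ ≤ ε} ≥
              ENNReal.ofReal (1 - δ) := by
  refine ⟨2048, by norm_num, fun k d σ ρ hk hd hσ hρ => ?_⟩
  have hk0 : (0 : ℝ) < k := by exact_mod_cast hk
  have hD : ∀ i, (d i : ℝ) ≤ (Finset.univ.sup d : ℕ) := fun i => by
    exact_mod_cast Finset.le_sup (f := d) (Finset.mem_univ i)
  have hD0 : (0 : ℝ) < (Finset.univ.sup d : ℕ) :=
    lt_of_lt_of_le (by exact_mod_cast hd ⟨0, hk⟩) (hD ⟨0, hk⟩)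
  refine ⟨2048 * (ρ * k * (Finset.univ.sup d : ℕ) / σ ^ 4), by positivity, le_rfl, ?_⟩
  intro S hS n Y hY router hrouter hqda ε δ hε hδ hδ1 hn
  have hprob := fun j => isProbabilityMeasure_classLaw hS hσ (Y j)
  have hprobT : IsProbabilityMeasure (trainingLaw S σ Y) := by
    unfold trainingLaw; infer_instance
  rcases le_total 1 ε with hε1 | hε1
  · have huniv : {X | misclassRisk S σ (router X) - optimalRisk S σ ≤ ε} = Set.univ :=
      Set.eq_univ_of_forall fun X => (misclassRisk_sub_optimalRisk_le_one hS hσ _).trans hε1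
    rw [huniv, measure_univ]
    exact ENNReal.ofReal_le_one.2 (by linarith)
  have hsize : ∀ i, 2048 * d i * max (d i : ℝ) (Real.log (k / δ)) ≤
      ε ^ 2 * (classCount Y i : ℝ) := by
    intro i
    have hM : σ ^ 4 ≤ maxCovNorm S σ ^ 2 := by
      have := pow_le_pow_left₀ (by positivity) (sq_le_maxCovNorm (σ := σ) hS i (hd i)) 2
      rwa [← pow_mul] at this
    have hL0 : ∀ j, 0 ≤ max (d j : ℝ) (Real.log (k / δ)) := fun j =>
      (Nat.cast_nonneg _).trans (le_max_left _ _)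
    -- Only the summand of class `i` is kept from the sample-size hypothesis.
    have hL := Finset.single_le_sum (fun j _ => hL0 j) (Finset.mem_univ i)
    have hcount := hn.trans (sample_size_le_mul_classCount hY i)
    have h1 : 2048 * (ρ * k * d i / σ ^ 4) * (σ ^ 4 / ε ^ 2) *
        max (d i : ℝ) (Real.log (k / δ)) ≤ k * (ρ * classCount Y i) := by
      refine le_trans ?_ hcount
      have := hL0 i
      gcongr
      exact_mod_cast hD i
    have h2 : 2048 * (ρ * k * d i / σ ^ 4) * (σ ^ 4 / ε ^ 2) *
        max (d i : ℝ) (Real.log (k / δ)) =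
        k * ρ * (2048 * d i * max (d i : ℝ) (Real.log (k / δ)) / ε ^ 2) := by
      field_simp
    rw [h2, ← mul_assoc] at h1
    have h3 := le_of_mul_le_mul_left h1 (by positivity)
    rw [div_le_iff₀ (by positivity)] at h3
    linarith
  have hd0 : ∀ i, (1 : ℝ) ≤ d i := fun i => by exact_mod_cast hd i
  have hcount : ∀ i, 0 < classCount Y i := by
    intro i
    have h1 : (0 : ℝ) < 2048 * d i * max (d i : ℝ) (Real.log (k / δ)) := by
      have := hd0 i
      have := lt_max_of_lt_left (c := Real.log (k / δ)) (show (0 : ℝ) < d i by linarith)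
      positivity
    have h2 := h1.trans_le (hsize i)
    exact_mod_cast pos_of_mul_pos_right h2 (by positivity)
  set s : Fin k → ℝ := fun i => √(ε ^ 2 / (32 * d i)) with hsdef
  have hpos : ∀ i, 0 < ε ^ 2 / (32 * d i) := fun i => by
    have := hd0 i
    positivity
  have hs0 : ∀ i, 0 < s i := fun i => Real.sqrt_pos.2 (hpos i)
  have hs2 : ∀ i, s i ^ 2 = ε ^ 2 / (32 * d i) := fun i => Real.sq_sqrt (hpos i).le
  have hs1 : ∀ i, s i ≤ 1 := fun i => by
    refine Real.sqrt_le_one.2 ?_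
    have := hd0 i
    rw [div_le_one (by positivity)]
    nlinarith
  set G := {X | misclassRisk S σ (router X) - optimalRisk S σ ≤ ε} with hG
  have hbad : Gᶜ ⊆ ⋃ i ∈ Finset.univ, {X | 4 * s i <
      ‖Matrix.toEuclideanCLM (𝕜 := ℝ) (whitenedError S σ Y X i)‖} := by
    intro X hX
    by_contra hno
    simp only [Finset.mem_univ, Set.iUnion_true, Set.mem_iUnion, not_exists, Set.mem_ofPred_eq,
      not_lt] at hno
    exact hX (excess_risk_le_of_whitenedError hS hσ hk hd
      (hrouter.comp measurable_prodMk_left) (hqda X) hε hε1 hs2 hno)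
  have hbadle : (trainingLaw S σ Y).real Gᶜ ≤ δ := by
    calc _ ≤ _ := measureReal_mono hbad (measure_ne_top _ _)
      _ ≤ _ := measureReal_biUnion_finset_le _ _
      _ ≤ ∑ _i : Fin k, δ / k := Finset.sum_le_sum fun i _ =>
          (trainingLaw_whitenedError_tail hS hσ Y i (hcount i) (hs0 i) (hs1 i)).trans (by
            rw [hs2]; exact tail_le_of_sample_size (hd i) hk0 hδ (hsize i))
      _ = δ := by simp; field_simp
  -- Subadditivity suffices here, so measurability of the good event never has to be proved.
  have hone : 1 ≤ (trainingLaw S σ Y).real G + (trainingLaw S σ Y).real Gᶜ := by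
    have := measureReal_union_le (μ := trainingLaw S σ Y) G Gᶜ
    rwa [Set.union_compl_self, probReal_univ] at this
  rw [ge_iff_le, ← ofReal_measureReal]
  exact ENNReal.ofReal_le_ofReal (by linarith)
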